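/- Setting. A data point is a sequence of random length $m\in\mathbb N$ with $m\sim q$; given $m$, it consists of an observation $X\in\mathcal X_m$ and a label sequence $Y=(Y_1,\dots,Y_m)\in A^m$ over a finite alphabet $A$. For $\theta$ in $\Theta\subset\mathbb R^r$ the pair $(X,Y)$ has density $p_\theta(x,y)>0$ with respect to the product of a $\sigma$-finite measure on $\mathcal X_m$ and counting measure on $A^m$; $q$ does not depend on $\theta$. A stochastic labeling policy is a mixture of $k$ deterministic ones: for $j=1,\dots,k$, with probability $\lambda_j$, it reveals the labels $\{Y_i:i\in S_j^m\}$, where $S_j^m\subset\{1,\dots,m\}$ are fixed sets. Write $p_\theta(\{Y_i:i\in S\},X)$ for the density of the partially observed data (the unobserved labels summed out), and let $$V_{jm}(\theta)=\log p_\theta(\{Y_i:i\in S_j^m\},X).$$ Let $(m^{(i)},X^{(i)},Y^{(i)},Z^{(i)})$, $i\ge1$, be i.i.d., where $(X^{(i)},Y^{(i)})$ has density $p_{\theta_0}$ given its length $m^{(i)}\sim q$, and $Z^{(i)}\sim\mathrm{Mult}(1,(\lambda_1,\dots,\lambda_k))$ is independent of $(m^{(i)},X^{(i)},Y^{(i)})$.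 Let $\hat\theta_n$ be a (measurable) maximizer over $\Theta$ of $$\ell_n(\theta)=\sum_{i=1}^n\sum_{j=1}^k Z_j^{(i)}\log p_\theta(\{Y^{(i)}_l:l\in S_j^{m^{(i)}}\},X^{(i)}).$$ Assumptions. 1. $\Theta$ is compact and convex, and $\theta_0$ is an interior point of $\Theta$. 2. $\lambda_1,\dots,\lambda_k>0$ and $\sum_j\lambda_j=1$. 3. $p_\theta$ is identifiable: if $p_\theta(X,Y)=p_\eta(X,Y)$ almost everywhere for every length $m$ with $q(m)>0$, then $\theta=\eta$. The policy is identifiable: if $p_\theta(\{Y_i:i\in S_j^m\},X)=p_\eta(\{Y_i:i\in S_j^m\},X)$ almost everywhere for all $j$ and all $m$ with $q(m)>0$, then $p_\theta(X,Y)=p_\eta(X,Y)$ almost everywhere for all $m$ with $q(m)>0$. 4. $\theta\mapsto p_\theta(x,y)$ is twice continuously differentiable on $\Theta$, with the classical regularity conditions: (a) there is a function $K$ of $(m,X,Y)$, integrable under $\theta_0$, such that for all $j$ and all $m$ with $q(m)>0$, $|V_{jm}(\theta)|\le K$ for all $\theta\in\Theta$, and $\|\nabla^2V_{jm}(\theta)\|\le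 K$ for all $\theta$ in a neighborhood of $\theta_0$; (b) for every $m$ with $q(m)>0$, $\|\nabla^2_\theta\, p_\theta(x,y)\|$ is bounded, for all $\theta$ in a neighborhood of $\theta_0$, by a function of $(x,y)$ that is integrable with respect to the base measure. 5. The information matrix $$\Sigma=\mathbb E_{q(m)}\Big\{\sum_{j=1}^k\lambda_j\,\mathrm{Var}_{\theta_0}\big(\nabla V_{jm}(\theta_0)\big)\Big\}$$ is nonsingular. Conclusion. The covariance matrices in $\Sigma$ exist for every $m$ with $q(m)>0$ (the scores $\nabla V_{jm}(\theta_0)$ are square integrable), the expectation over $q$ converges absolutely, and as $n\to\infty$ $$\sqrt n\,(\hat\theta_n-\theta_0)\ \to\ N(0,\Sigma^{-1})\quad\text{in distribution}.$$ -/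

import Mathlib

open MeasureTheory ProbabilityTheory Filter Topology
open scoped ENNReal

noncomputable section

/-- A parametric family of generative models for labelled sequences, with parameter set
`Θ ⊆ ℝʳ`. For each length `m` the observation `X` lies in `𝒳 m`, the label sequence `Y` lies in
`Aᵐ` (`A` a finite alphabet), and `(X, Y)` has a strictly positive probability density
`p_θ(x, y)` with respect to (a σ-finite base measure on `𝒳 m`) × (counting measure on `Aᵐ`). -/
structure SeqModel (r : ℕ) (A : Type*) [Fintype A] (𝒳 : ℕ → Type*)
    [∀ m, MeasurableSpace (𝒳 m)] (Θ : Set (EuclideanSpace ℝ (Fin r))) where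
  /-- base measure for the observations of length `m` -/
  base : ∀ m, Measure (𝒳 m)
  sigmaFinite_base : ∀ m, SigmaFinite (base m)
  /-- the joint density `p_θ(x, y)` on sequences of length `m` -/
  density : ∀ m, EuclideanSpace ℝ (Fin r) → 𝒳 m → (Fin m → A) → ℝ
  measurable_density : ∀ m, ∀ θ ∈ Θ, ∀ y, Measurable fun x => density m θ x y
  density_pos : ∀ m, ∀ θ ∈ Θ, ∀ x y, 0 < density m θ x y
  lintegral_density : ∀ m, ∀ θ ∈ Θ,
    ∑ y : Fin m → A, ∫⁻ x, ENNReal.ofReal (density m θ x y) ∂(base m) = 1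

/-- A full data point: a length `m`, an observation and a label sequence of length `m`. -/
abbrev SeqData (A : Type*) (𝒳 : ℕ → Type*) : Type _ := Σ m : ℕ, 𝒳 m × (Fin m → A)

namespace SeqModel

variable {r : ℕ} {A : Type*} [Fintype A] [DecidableEq A] [MeasurableSpace A]
  {𝒳 : ℕ → Type*} [∀ m, MeasurableSpace (𝒳 m)] {Θ : Set (EuclideanSpace ℝ (Fin r))}

/-- The law of `(X, Y)` on sequences of length `m` under the parameter `θ`. -/
def lawOfLength (M : SeqModel r A 𝒳 Θ) (θ : EuclideanSpace ℝ (Fin r)) (m : ℕ) :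
    Measure (𝒳 m × (Fin m → A)) :=
  ((M.base m).prod Measure.count).withDensity fun z => ENNReal.ofReal (M.density m θ z.1 z.2)

/-- The law of a full data point: the length has distribution `q`, and given length `m` the pair
`(X, Y)` has density `p_θ`. -/
def law (M : SeqModel r A 𝒳 Θ) (q : PMF ℕ) (θ : EuclideanSpace ℝ (Fin r)) :
    Measure (SeqData A 𝒳) :=
  Measure.sum fun m => q m • (M.lawOfLength θ m).map (Sigma.mk m)

/-- The partial-data density `p_θ({y_i : i ∈ S}, x)`: the unobserved labels are summed out.
It depends on `y` only through its coordinates in `S`. -/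
def partialDensity (M : SeqModel r A 𝒳 Θ) (m : ℕ) (S : Finset (Fin m))
    (θ : EuclideanSpace ℝ (Fin r)) (x : 𝒳 m) (y : Fin m → A) : ℝ :=
  ∑ y' : Fin m → A with ∀ i ∈ S, y' i = y i, M.density m θ x y'

/-- `p_θ(X, Y)` is identifiable: distinct parameters give densities that differ
(on a set of positive base measure, at a length of positive probability). -/
def Identifiable (M : SeqModel r A 𝒳 Θ) (q : PMF ℕ) : Prop :=
  ∀ θ ∈ Θ, ∀ η ∈ Θ,
    (∀ m, q m ≠ 0 → ∀ y, ∀ᵐ x ∂(M.base m), M.density m θ x y = M.density m η x y) → θ = η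

/-- The labelling policy that reveals the labels in `S j m` on length-`m` sequences
(`j = 1, …, k`) is identifiable: the collection of partial-data distributions, over all `j` and all
lengths `m` of positive probability, determines the joint distribution. -/
def PolicyIdentifiable (M : SeqModel r A 𝒳 Θ) (q : PMF ℕ) {k : ℕ}
    (S : Fin k → ∀ m, Finset (Fin m)) : Prop :=
  ∀ θ ∈ Θ, ∀ η ∈ Θ,
    (∀ m, q m ≠ 0 → ∀ j y, ∀ᵐ x ∂(M.base m),
      M.partialDensity m (S j m) θ x y = M.partialDensity m (S j m) η x y) →
    ∀ m, q m ≠ 0 → ∀ y, ∀ᵐ x ∂(M.base m), M.density m θ x y = M.density m η x y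

/-- `log p_θ({y_i : i ∈ S}, x)`. -/
def logPartial (M : SeqModel r A 𝒳 Θ) (m : ℕ) (S : Finset (Fin m))
    (z : 𝒳 m × (Fin m → A)) (θ : EuclideanSpace ℝ (Fin r)) : ℝ :=
  Real.log (M.partialDensity m S θ z.1 z.2)

/-- The score `∇_θ log p_θ({y_i : i ∈ S}, x)`. -/
def score (M : SeqModel r A 𝒳 Θ) (m : ℕ) (S : Finset (Fin m))
    (θ : EuclideanSpace ℝ (Fin r)) (z : 𝒳 m × (Fin m → A)) : EuclideanSpace ℝ (Fin r) :=
  gradient (M.logPartial m S z) θ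

/-- The covariance matrix under `p_θ` of the score of the partial data, on length-`m` sequences. -/
def scoreCov (M : SeqModel r A 𝒳 Θ) (m : ℕ) (S : Finset (Fin m))
    (θ : EuclideanSpace ℝ (Fin r)) : Matrix (Fin r) (Fin r) ℝ :=
  Matrix.of fun a b =>
    cov[fun z => M.score m S θ z a, fun z => M.score m S θ z b; M.lawOfLength θ m]

/-- The information matrix `E_{q(m)} ∑ⱼ λⱼ Var_θ(∇ log p_θ({Y_i : i ∈ S j m}, X))`. -/
def infoMatrix (M : SeqModel r A 𝒳 Θ) (q : PMF ℕ) {k : ℕ} (lam : Fin k → ℝ)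
    (S : Fin k → ∀ m, Finset (Fin m)) (θ : EuclideanSpace ℝ (Fin r)) :
    Matrix (Fin r) (Fin r) ℝ :=
  Matrix.of fun a b => ∑' m, (q m).toReal * ∑ j, lam j * M.scoreCov m (S j m) θ a b

/-- The log-likelihood of the first `n` partially labelled data points,
`ℓₙ(θ) = ∑ᵢ ∑ⱼ Zⱼ⁽ⁱ⁾ log p_θ(χⱼ(Y⁽ⁱ⁾), X⁽ⁱ⁾)`, where `Zⱼ⁽ⁱ⁾ = 1` if the `i`-th labelling draw `c i`
equals `j`, and `0` otherwise. -/
def logLik (M : SeqModel r A 𝒳 Θ) {k : ℕ} (S : Fin k → ∀ m, Finset (Fin m))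
    (d : ℕ → SeqData A 𝒳) (c : ℕ → Fin k) (n : ℕ) (θ : EuclideanSpace ℝ (Fin r)) : ℝ :=
  ∑ i ∈ Finset.range n, ∑ j : Fin k,
    (if c i = j then 1 else 0) * M.logPartial (d i).1 (S j (d i).1) (d i).2 θ

end SeqModel

/-- The distribution on `{1, …, k}` with weights `lam`. -/
def policyLaw {k : ℕ} (lam : Fin k → ℝ) : Measure (Fin k) :=
  ∑ j, ENNReal.ofReal (lam j) • Measure.dirac j

end

/-! The estimator is a maximum likelihood estimator for i.i.d. pairs (data point, labelling draw),
with criterion V(w, θ) the log-density of what the draw reveals (`logLikTerm`). The proof joins a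
general theorem on M-estimators to identities for partially observed likelihoods.

M-estimation (`tendstoInDistribution_of_isMaxOn_sum`): a uniform law of large numbers on the compact
parameter set forces the maximizers to converge to the unique maximizer θ₀ of the mean criterion.
Near θ₀ the averaged Hessians converge uniformly, with limit -J at θ₀. Expanding the vanishing
gradient at the estimator therefore shows that √n (θ̂ - θ₀) equals J⁻¹ applied to the normalized sum
of scores, up to an error small relative to √n (θ̂ - θ₀) itself. The central limit theorem and a
Slutsky argument conclude, with covariance J⁻¹ J J⁻¹ = J⁻¹.

Likelihood: averaging over hidden labels cancels the partial density (`sum_mul_labelSum_div`), so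
partial likelihood ratios have mean one. With eˣ ≥ 1 + x this makes θ₀ a maximizer of the mean
criterion, and the two identifiability hypotheses make it the only one. Differentiating "total mass
= 1" twice under the integral gives centred scores and the information equality, for each length and
label set. As the Hessian of V is dominated, the information equality also yields square
integrability of the scores. Writing the law of the data as a mixture over lengths and draws
(`law_prod_policyLaw`) transfers all this to the full model. -/

section MEstimation

/-! ### Uniform laws of large numbers and consistency -/

/-- A map into `C(K, ℝ)`, `K` compact metric, is measurable if all its evaluations are. -/
theorem measurable_continuousMap_of_eval {Z X : Type*} [MeasurableSpace Z]
    [MetricSpace X] [CompactSpace X] [MeasurableSpace C(X, ℝ)] [BorelSpace C(X, ℝ)]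
    {f : Z → C(X, ℝ)} (hf : ∀ x, Measurable fun z => f z x) : Measurable f := by
  have hball : ∀ (g : C(X, ℝ)) (ε : ℝ), 0 ≤ ε → MeasurableSet (f ⁻¹' Metric.closedBall g ε) := by
    intro g ε hε
    obtain ⟨t, htc, htd⟩ := TopologicalSpace.exists_countable_dense X
    -- By continuity the sup-norm bound need only be tested on a countable dense set.
    have : f ⁻¹' Metric.closedBall g ε = ⋂ x ∈ t, {z | dist (f z x) (g x) ≤ ε} := by
      ext z
      simp only [Set.mem_preimage, Metric.mem_closedBall, Set.mem_iInter, Set.mem_ofPred_eq]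
      rw [ContinuousMap.dist_le hε]
      refine ⟨fun h x _ => h x, fun h x => ?_⟩
      have hcl : IsClosed {x | dist (f z x) (g x) ≤ ε} :=
        isClosed_le (by fun_prop) continuous_const
      exact (hcl.closure_subset_iff.2 (fun x hx => h x hx)) (htd x)
    rw [this]
    exact MeasurableSet.biInter htc fun x _ =>
      measurableSet_le ((hf x).dist measurable_const) measurable_const
  refine measurable_of_isOpen fun O hO => ?_
  obtain ⟨t, htc, htd⟩ := TopologicalSpace.exists_countable_dense C(X, ℝ)
  -- `C(X, ℝ)` is separable, so an open set is a countable union of closed balls about dense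
  -- centres. If 1/(n+1) < ε/2, such a ball containing `f z` lies within ε of `f z`.
  have : f ⁻¹' O = ⋃ g ∈ t, ⋃ n : ℕ, ⋃ _ : Metric.closedBall g (1 / ((n : ℝ) + 1)) ⊆ O,
      f ⁻¹' Metric.closedBall g (1 / ((n : ℝ) + 1)) := by
    ext z
    simp only [Set.mem_preimage, Set.mem_iUnion, exists_prop]
    constructor
    · intro hz
      obtain ⟨ε, hε, hεO⟩ := Metric.isOpen_iff.1 hO _ hz
      obtain ⟨n, hn⟩ := exists_nat_one_div_lt (half_pos hε)
      obtain ⟨g, hgt, hg⟩ := htd.exists_dist_lt (f z) (Nat.one_div_pos_of_nat (n := n) (α := ℝ))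
      refine ⟨g, hgt, n, fun h hh => hεO ?_, by simpa using hg.le⟩
      rw [Metric.mem_ball]
      have h1 := Metric.mem_closedBall.1 hh
      have h2 := dist_triangle h g (f z)
      rw [dist_comm g] at h2
      linarith
    · rintro ⟨g, -, n, hsub, hz⟩
      exact hsub hz
  rw [this]
  exact MeasurableSet.biUnion htc fun g _ => MeasurableSet.iUnion fun n =>
    MeasurableSet.iUnion fun _ => hball g _ (by positivity)

/-- Uniform strong law of large numbers for a continuous, dominated class of functions indexed by
a compact set. -/
theorem uniform_strong_law {Z E Ω : Type*} [MeasurableSpace Z] [MetricSpace E]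
    [MeasurableSpace Ω] {P : Measure Ω} [IsProbabilityMeasure P] {ν : Measure Z}
    {K : Set E} (hK : IsCompact K) {f : Z → E → ℝ}
    (hfm : ∀ θ ∈ K, Measurable fun z => f z θ) (hfc : ∀ z, ContinuousOn (f z) K)
    {B : Z → ℝ} (hB : Integrable B ν) (hbd : ∀ᵐ z ∂ν, ∀ θ ∈ K, |f z θ| ≤ B z)
    {W : ℕ → Ω → Z} (hlaw : ∀ i, HasLaw (W i) ν P) (hindep : iIndepFun W P) :
    ContinuousOn (fun θ => ∫ z, f z θ ∂ν) K ∧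
    ∀ᵐ ω ∂P, TendstoUniformlyOn (fun (n : ℕ) θ => (n : ℝ)⁻¹ * ∑ i ∈ Finset.range n, f (W i ω) θ)
      (fun θ => ∫ z, f z θ ∂ν) atTop K := by
  have : CompactSpace K := isCompact_iff_compactSpace.1 hK
  let _ : MeasurableSpace C(K, ℝ) := borel _
  have : BorelSpace C(K, ℝ) := ⟨rfl⟩
  -- View z ↦ f(z, ·) as a random element of the separable Banach space C(K, ℝ), Bochner integrable
  -- thanks to `B`. The Banach-valued strong law is then convergence in sup norm.
  let F : Z → C(K, ℝ) := fun z => ⟨K.domRestrict (f z), (hfc z).domRestrict⟩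
  have hF : ∀ z (θ : K), F z θ = f z θ := fun _ _ => rfl
  have hFm : Measurable F := measurable_continuousMap_of_eval fun θ => hfm θ θ.2
  have hFi : Integrable F ν := by
    refine Integrable.mono' hB.norm hFm.aestronglyMeasurable ?_
    filter_upwards [hbd] with z hz
    rw [ContinuousMap.norm_le _ (norm_nonneg _)]
    exact fun θ => (hz θ θ.2).trans (le_abs_self _)
  have hint : ∀ θ : K, (∫ z, F z ∂ν) θ = ∫ z, f z θ ∂ν := fun θ =>
    ((ContinuousMap.evalCLM ℝ θ).integral_comp_comm hFi).symm
  have hid : ∀ i, HasLaw (fun ω => F (W i ω)) (ν.map F) P := fun i =>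
    ⟨hFm.comp_aemeasurable (hlaw i).aemeasurable, by
      rw [← (hlaw i).map_eq, AEMeasurable.map_map_of_aemeasurable hFm.aemeasurable
        (hlaw i).aemeasurable]; rfl⟩
  constructor
  · rw [continuousOn_iff_continuous_domRestrict]
    refine (∫ z, F z ∂ν).continuous.congr fun θ => ?_
    rw [hint]; rfl
  · have hsl := strong_law_ae (μ := P) (fun i ω => F (W i ω))
      (by
        have := (hlaw 0).map_eq ▸ hFi
        exact this.comp_aemeasurable (hlaw 0).aemeasurable)
      (fun i j hij => (hindep.comp (fun _ => F) (fun _ => hFm)).indepFun hij)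
      (fun i => ⟨(hid i).aemeasurable, (hid 0).aemeasurable, by
        rw [(hid i).map_eq, (hid 0).map_eq]⟩)
    have h0 : ∫ ω, F (W 0 ω) ∂P = ∫ z, F z ∂ν :=
      (hlaw 0).integral_comp hFm.aestronglyMeasurable
    filter_upwards [hsl] with ω hω
    rw [h0, ContinuousMap.tendsto_iff_tendstoUniformly] at hω
    rw [tendstoUniformlyOn_iff_tendstoUniformly_comp_coe]
    convert hω using 1
    · ext n θ
      simp [hF]
    · ext θ
      exact (hint θ).symm

/-- Maximizers of uniformly convergent functions on a compact set converge to the unique maximizer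
of the limit. -/
theorem tendsto_of_isMaxOn_of_tendstoUniformlyOn {E : Type*} [MetricSpace E] {K : Set E}
    (hK : IsCompact K) {F : ℕ → E → ℝ} {L : E → ℝ} (hL : ContinuousOn L K)
    (hF : TendstoUniformlyOn F L atTop K) {θ₀ : E} (hθ₀ : θ₀ ∈ K)
    (huniq : ∀ θ ∈ K, L θ₀ ≤ L θ → θ = θ₀) {t : ℕ → E} (htK : ∀ n, t n ∈ K)
    (hmax : ∀ᶠ n in atTop, IsMaxOn (F n) K (t n)) : Tendsto t atTop (𝓝 θ₀) := by
  rw [Metric.tendsto_nhds]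
  intro ε hε
  by_cases hne : (K \ Metric.ball θ₀ ε).Nonempty
  · obtain ⟨η, hη, hηmax⟩ := (hK.diff Metric.isOpen_ball).exists_isMaxOn hne
      (hL.mono Set.sdiff_subset)
    have hlt : L η < L θ₀ := by
      by_contra h
      have := huniq η hη.1 (not_lt.1 h)
      exact hη.2 (this ▸ Metric.mem_ball_self hε)
    -- Half the gap between θ₀ and the best point outside the ball: uniform errors at θ₀ and at `t
    -- n` together cannot close the gap.
    have hδ : 0 < (L θ₀ - L η) / 2 := by linarith
    filter_upwards [hmax, Metric.tendstoUniformlyOn_iff.1 hF _ hδ] with n hn hun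
    by_contra hfar
    have htmem : t n ∈ K \ Metric.ball θ₀ ε := ⟨htK n, by simpa using hfar⟩
    have h1 : L (t n) ≤ L η := hηmax htmem
    have h2 : F n θ₀ ≤ F n (t n) := hn hθ₀
    have h3 := abs_lt.1 (Real.dist_eq _ _ ▸ hun θ₀ hθ₀)
    have h4 := abs_lt.1 (Real.dist_eq _ _ ▸ hun (t n) (htK n))
    linarith [h3.1, h3.2, h4.1, h4.2]
  · filter_upwards with n
    by_contra hfar
    exact hne ⟨t n, htK n, by simpa using hfar⟩

/-! ### Slutsky argument and multivariate central limit theorem -/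

/-- A relative perturbation that vanishes almost surely does not change the limit in
distribution. -/
theorem tendstoInDistribution_of_relative_error {E Ω Ω' : Type*} [NormedAddCommGroup E]
    [NormedSpace ℝ E] [SecondCountableTopology E] [MeasurableSpace E] [BorelSpace E]
    [MeasurableSpace Ω] {P : Measure Ω} [IsProbabilityMeasure P]
    [MeasurableSpace Ω'] {P' : Measure Ω'} [IsProbabilityMeasure P']
    {Q T : ℕ → Ω → E} {Y : Ω' → E} (hQ : TendstoInDistribution Q atTop Y (fun _ => P) P')
    (hT : ∀ n, AEMeasurable (T n) P)
    (herr : ∀ᵐ ω ∂P, ∀ ε > 0, ∀ᶠ n in atTop, ‖T n ω - Q n ω‖ ≤ ε * ‖T n ω‖) :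
    TendstoInDistribution T atTop Y (fun _ => P) P' := by
  -- Dividing by 1 + ‖Q‖ makes the error tend to zero almost surely with no tightness argument,
  -- while T = Q + (1 + ‖Q‖) e stays a continuous function of (Q, e).
  let e : ℕ → Ω → E := fun n ω => (1 + ‖Q n ω‖)⁻¹ • (T n ω - Q n ω)
  have hQm := hQ.forall_aemeasurable
  have hem : ∀ n, AEMeasurable (e n) P := fun n =>
    ((hQm n).norm.const_add 1).inv.smul ((hT n).sub (hQm n))
  have he : ∀ᵐ ω ∂P, Tendsto (fun n => e n ω) atTop (𝓝 0) := by
    filter_upwards [herr] with ω hω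
    rw [tendsto_zero_iff_norm_tendsto_zero, Metric.tendsto_nhds]
    intro ε hε
    -- The 1/2 absorbs ‖T‖ into the left side, giving ‖T‖ ≤ 2‖Q‖; the ε/4 then bounds the error by
    -- (ε/2)‖Q‖.
    have hδ : 0 < min (1 / 2) (ε / 4) := by positivity
    filter_upwards [hω _ hδ] with n hn
    have h1 : ‖T n ω‖ ≤ ‖T n ω - Q n ω‖ + ‖Q n ω‖ := norm_le_norm_sub_add _ _
    have h2 : min (1 / 2) (ε / 4) ≤ 1 / 2 := min_le_left _ _
    have h3 : min (1 / 2) (ε / 4) ≤ ε / 4 := min_le_right _ _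
    have h4 : ‖T n ω - Q n ω‖ ≤ ‖Q n ω‖ := by
      nlinarith [mul_le_mul_of_nonneg_right h2 (norm_nonneg (T n ω))]
    have h5 : ‖T n ω - Q n ω‖ ≤ ε / 4 * (2 * ‖Q n ω‖) :=
      hn.trans (mul_le_mul h3 (by linarith) (norm_nonneg _) (by positivity))
    simp only [e, norm_smul, norm_inv, dist_zero_right, norm_norm, norm_mul]
    have hpos : 0 < 1 + ‖Q n ω‖ := by positivity
    rw [Real.norm_of_nonneg hpos.le, inv_mul_lt_iff₀ hpos]
    nlinarith [norm_nonneg (Q n ω)]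
  have hg : Continuous fun p : E × E => p.1 + (1 + ‖p.1‖) • p.2 := by fun_prop
  have := hQ.continuous_comp_prodMk_of_tendstoInMeasure_const hg
    (tendstoInMeasure_of_tendsto_ae (fun n => (hem n).aestronglyMeasurable) he) hem
  convert this using 3 with n ω
  · have hpos : 1 + ‖Q n ω‖ ≠ 0 := by positivity
    simp only [e, smul_smul]
    rw [mul_inv_cancel₀ hpos, one_smul]
    abel
  · simp

/-- Central limit theorem in `ℝʳ`, for centred summands with covariance matrix `S`. -/
theorem tendstoInDistribution_multivariateGaussian {r : ℕ} {Ω : Type*} [MeasurableSpace Ω]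
    {P : Measure Ω} [IsProbabilityMeasure P] {X : ℕ → Ω → EuclideanSpace ℝ (Fin r)}
    (hindep : iIndepFun X P) (hident : ∀ i, IdentDistrib (X i) (X 0) P P)
    {S : Matrix (Fin r) (Fin r) ℝ} (hS : S.PosSemidef)
    (hL2 : ∀ t, MemLp (fun ω => inner ℝ (X 0 ω) t) 2 P)
    (hmean : ∀ t, ∫ ω, inner ℝ (X 0 ω) t ∂P = 0)
    (hcov : ∀ t, ∫ ω, (inner ℝ (X 0 ω) t : ℝ) ^ 2 ∂P = t.ofLp ⬝ᵥ S.mulVec t.ofLp) :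
    TendstoInDistribution (fun (n : ℕ) ω => (√n)⁻¹ • ∑ i ∈ Finset.range n, X i ω) atTop id
      (fun _ => P) (multivariateGaussian 0 S) where
  forall_aemeasurable n :=
    (Finset.aemeasurable_fun_sum _ fun i _ => (hident i).aemeasurable_fst).fun_const_smul _
  tendsto := by
    have hm : ∀ n : ℕ, AEMeasurable (fun ω => (√n)⁻¹ • ∑ i ∈ Finset.range n, X i ω) P := fun n =>
      (Finset.aemeasurable_fun_sum _ fun i _ => (hident i).aemeasurable_fst).fun_const_smul _
    refine ProbabilityMeasure.tendsto_iff_tendsto_charFun.2 fun t => ?_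
    have hti : Measurable fun x : EuclideanSpace ℝ (Fin r) => (inner ℝ x t : ℝ) := by fun_prop
    have hvar : Var[fun ω => inner ℝ (X 0 ω) t; P] = t.ofLp ⬝ᵥ S.mulVec t.ofLp := by
      rw [variance_eq_integral (X := fun ω => (inner ℝ (X 0 ω) t : ℝ)) (hti.comp_aemeasurable (hident 0).aemeasurable_fst), hmean t,
        ← hcov t]
      simp
    have h1 := tendstoInDistribution_inv_sqrt_mul_sum_sub (P := P)
      (X := fun i ω => (inner ℝ (X i ω) t : ℝ)) (Y := id)
      (P' := gaussianReal 0 (Var[fun ω => inner ℝ (X 0 ω) t; P]).toNNReal) HasLaw.id (hL2 t)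
      (hindep.comp (fun _ x => inner ℝ x t) fun _ => hti) (fun i => (hident i).comp hti)
    -- Cramér–Wold: the characteristic function of the vector sum at t is that of its projection on
    -- t at 1.
    have h2 := ProbabilityMeasure.tendsto_iff_tendsto_charFun.1 h1.tendsto 1
    simp only [ProbabilityMeasure.coe_mk, Measure.map_id, charFun_gaussianReal, hmean t] at h2 ⊢
    rw [charFun_multivariateGaussian hS]
    have hnn : 0 ≤ t.ofLp ⬝ᵥ S.mulVec t.ofLp := by
      rw [← hcov t]; exact integral_nonneg fun _ => sq_nonneg _
    convert h2 using 2
    · rename_i n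
      have hr : AEMeasurable (fun ω => (√n)⁻¹ * (∑ i ∈ Finset.range n, (inner ℝ (X i ω) t : ℝ)
          - n * 0)) P := by
        have := h1.forall_aemeasurable n
        simpa only [hmean t] using this
      rw [charFun_apply, charFun_apply, integral_map (hm n) (by fun_prop),
        integral_map hr (by fun_prop)]
      congr 1
      ext ω
      simp [real_inner_smul_left, sum_inner]
    · simp [hvar, Real.coe_toNNReal _ hnn]

/-! ### Measurability of derivatives and coordinates -/

/-- Directional derivatives depend measurably on a parameter. -/
theorem measurable_fderiv_apply {Z E : Type*} [MeasurableSpace Z] [NormedAddCommGroup E]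
    [NormedSpace ℝ E] {f : Z → E → ℝ} {U : Set E} (hU : IsOpen U)
    (hfm : ∀ θ ∈ U, Measurable fun z => f z θ) {θ : E} (hθ : θ ∈ U)
    (hfd : ∀ z, DifferentiableAt ℝ (f z) θ) (v : E) :
    Measurable fun z => fderiv ℝ (f z) θ v := by
  have hlim : Tendsto (fun n : ℕ => θ + (n : ℝ)⁻¹ • v) atTop (𝓝 θ) := by
    have : Tendsto (fun n : ℕ => (n : ℝ)⁻¹) atTop (𝓝 0) := tendsto_inv_atTop_nhds_zero_nat
    simpa using (this.smul_const v).const_add θ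
  -- Measurability is known only on `U`, so the difference quotients start at an index `N` past
  -- which θ + v/n lies in `U`.
  obtain ⟨N, hN⟩ := eventually_atTop.1 (hlim.eventually (hU.mem_nhds hθ))
  refine measurable_of_tendsto_metrizable (f := fun (n : ℕ) z =>
    ((n + N : ℕ) : ℝ) • (f z (θ + ((n + N : ℕ) : ℝ)⁻¹ • v) - f z θ)) (fun n => ?_) ?_
  · exact ((hfm _ (hN _ (Nat.le_add_left _ _))).sub (hfm θ hθ)).const_mul _
  · rw [tendsto_pi_nhds]
    intro z
    exact ((hfd z).hasFDerivAt.lim_real v).comp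
      (tendsto_natCast_atTop_atTop.comp (tendsto_add_atTop_nat N))

theorem fderiv_fderiv_apply {E : Type*} [NormedAddCommGroup E] [NormedSpace ℝ E] {f : E → ℝ}
    {θ : E} (hf : DifferentiableAt ℝ (fderiv ℝ f) θ) (u v : E) :
    fderiv ℝ (fun η => fderiv ℝ f η v) θ u = fderiv ℝ (fderiv ℝ f) θ u v := by
  rw [fderiv_clm_apply hf (differentiableAt_const v)]
  simp

/-- Second directional derivatives depend measurably on a parameter. -/
theorem measurable_fderiv_fderiv_apply {Z E : Type*} [MeasurableSpace Z] [NormedAddCommGroup E]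
    [NormedSpace ℝ E] {f : Z → E → ℝ} {U : Set E} (hU : IsOpen U)
    (hfm : ∀ θ ∈ U, Measurable fun z => f z θ) (hfc : ∀ z, ContDiffOn ℝ 2 (f z) U)
    {θ : E} (hθ : θ ∈ U) (u v : E) :
    Measurable fun z => fderiv ℝ (fderiv ℝ (f z)) θ u v := by
  have hd : ∀ z, ∀ η ∈ U, DifferentiableAt ℝ (fderiv ℝ (f z)) η := fun z η hη =>
    (((hfc z).fderiv_of_isOpen hU (m := 1) (by norm_num)).contDiffAt
      (hU.mem_nhds hη)).differentiableAt (by norm_num)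
  have := measurable_fderiv_apply (f := fun z η => fderiv ℝ (f z) η v) hU
    (fun η hη => measurable_fderiv_apply hU hfm hη
      (fun z => ((hfc z).contDiffAt (hU.mem_nhds hη)).differentiableAt (by norm_num)) v) hθ
    (fun z => (hd z θ hθ).clm_apply (differentiableAt_const v)) u
  simpa only [fun z => fderiv_fderiv_apply (hd z θ hθ) u v] using this

theorem euclideanSpace_eq_sum_single {r : ℕ} (x : EuclideanSpace ℝ (Fin r)) :
    x = ∑ a, x a • EuclideanSpace.single a (1 : ℝ) := by
  ext b
  simp [Finset.sum_apply, Pi.single_apply]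

/-- Turns entrywise estimates on Hessians into operator-norm estimates. -/
theorem norm_le_sum_abs_single {r : ℕ} (L : EuclideanSpace ℝ (Fin r) →L[ℝ] ℝ) :
    ‖L‖ ≤ ∑ a, |L (EuclideanSpace.single a 1)| := by
  refine L.opNorm_le_bound (Finset.sum_nonneg fun _ _ => abs_nonneg _) fun x => ?_
  conv_lhs => rw [euclideanSpace_eq_sum_single x]
  rw [map_sum, Finset.sum_mul]
  refine (norm_sum_le _ _).trans (Finset.sum_le_sum fun a _ => ?_)
  rw [map_smul, norm_smul, mul_comm]
  exact mul_le_mul_of_nonneg_left (PiLp.norm_apply_le x a) (abs_nonneg _)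

/-! ### Expansion at critical points and asymptotic normality -/

/-- First-order expansion of the gradients of a sequence of functions at their critical points,
when the Hessians converge uniformly. -/
theorem eventually_abs_fderiv_add_sum_le {r : ℕ} {θ₀ : EuclideanSpace ℝ (Fin r)} {ρ : ℝ}
    (hρ : 0 < ρ) {g : ℕ → EuclideanSpace ℝ (Fin r) → ℝ}
    (hg : ∀ n, ∀ θ ∈ Metric.ball θ₀ ρ, DifferentiableAt ℝ (fderiv ℝ (g n)) θ)
    {H : Fin r → Fin r → EuclideanSpace ℝ (Fin r) → ℝ}
    (hH : ∀ a b, ContinuousOn (H a b) (Metric.closedBall θ₀ ρ))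
    (hunif : ∀ a b, TendstoUniformlyOn
      (fun n θ => fderiv ℝ (fderiv ℝ (g n)) θ (EuclideanSpace.single a 1)
        (EuclideanSpace.single b 1)) (H a b) atTop (Metric.closedBall θ₀ ρ))
    {t : ℕ → EuclideanSpace ℝ (Fin r)} (ht : Tendsto t atTop (𝓝 θ₀))
    (hcrit : ∀ᶠ n in atTop, fderiv ℝ (g n) (t n) = 0) {ε : ℝ} (hε : 0 < ε) :
    ∀ᶠ n in atTop, ∀ b, |fderiv ℝ (g n) θ₀ (EuclideanSpace.single b 1)
      + ∑ a, (t n - θ₀) a * H a b θ₀| ≤ ε * ‖t n - θ₀‖ := by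
  rw [eventually_all]
  intro b
  -- The limiting derivative at θ₀ of the b-th partial derivative. The mean value inequality,
  -- applied after subtracting this fixed linear map, avoids intermediate points.
  let Φ : EuclideanSpace ℝ (Fin r) →L[ℝ] ℝ := ∑ a, H a b θ₀ • EuclideanSpace.proj a
  have hΦ : ∀ x, Φ x = ∑ a, x a * H a b θ₀ := fun x => by
    simp [Φ, mul_comm]
  -- Each of the r coordinates incurs two errors, from uniform convergence and from continuity of
  -- the limit; r + 1 keeps the denominator nonzero when r = 0.
  have hη : 0 < ε / (2 * (r + 1)) := by positivity
  have hHc : ∀ᶠ θ in 𝓝 θ₀, ∀ a, |H a b θ - H a b θ₀| < ε / (2 * (r + 1)) := by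
    rw [eventually_all]
    intro a
    have := (hH a b).continuousAt (Metric.closedBall_mem_nhds θ₀ hρ)
    exact (Metric.tendsto_nhds.1 this _ hη).mono fun θ h => by rwa [Real.dist_eq] at h
  obtain ⟨δ, hδ, hball⟩ := Metric.eventually_nhds_iff_ball.1
    (hHc.and (Metric.ball_mem_nhds θ₀ hρ))
  have hun : ∀ᶠ n in atTop, ∀ a, ∀ θ ∈ Metric.closedBall θ₀ ρ,
      dist (H a b θ) (fderiv ℝ (fderiv ℝ (g n)) θ (EuclideanSpace.single a 1)
        (EuclideanSpace.single b 1)) < ε / (2 * (r + 1)) :=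
    eventually_all.2 fun a => Metric.tendstoUniformlyOn_iff.1 (hunif a b) _ hη
  filter_upwards [hcrit, hun, ht.eventually (Metric.ball_mem_nhds θ₀ hδ)] with n hc hn htn
  have key := Convex.norm_image_sub_le_of_norm_fderiv_le' (𝕜 := ℝ)
    (f := fun θ => fderiv ℝ (g n) θ (EuclideanSpace.single b 1)) (φ := Φ) (C := ε)
    (s := Metric.ball θ₀ δ) (x := θ₀) (y := t n)
    (fun θ hθ => (hg n θ (hball θ hθ).2).clm_apply (differentiableAt_const _))
    (fun θ hθ => by
      refine (norm_le_sum_abs_single _).trans ?_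
      have : ∀ a ∈ Finset.univ, |(fderiv ℝ (fun θ => fderiv ℝ (g n) θ (EuclideanSpace.single b 1)) θ
          - Φ) (EuclideanSpace.single a 1)| ≤ ε / (r + 1) := fun a _ => by
        rw [sub_apply, fderiv_fderiv_apply (hg n θ (hball θ hθ).2), hΦ]
        have h1 := (hball θ hθ).1 a
        have h2 := hn a θ (Metric.ball_subset_closedBall (hball θ hθ).2)
        rw [Real.dist_eq, abs_sub_comm] at h2
        have h3 : ∑ x, (EuclideanSpace.single a (1 : ℝ) : EuclideanSpace ℝ (Fin r)) x * H x b θ₀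
            = H a b θ₀ := by simp
        have h4 : ε / (r + 1) = ε / (2 * (r + 1)) + ε / (2 * (r + 1)) := by field_simp; ring
        rw [h3, h4]
        exact (abs_sub_le _ (H a b θ) _).trans (add_le_add h2.le h1.le)
      refine (Finset.sum_le_sum this).trans ?_
      rw [Finset.sum_const, Finset.card_univ, Fintype.card_fin, nsmul_eq_mul]
      rw [mul_div_assoc', div_le_iff₀ (by positivity)]
      nlinarith)
    (convex_ball θ₀ δ) (Metric.mem_ball_self hδ) htn
  rw [hc, hΦ] at key
  rwa [Real.norm_eq_abs, zero_apply, zero_sub, ← neg_add', abs_neg] at key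

theorem gradient_ofLp {r : ℕ} (f : EuclideanSpace ℝ (Fin r) → ℝ) (x : EuclideanSpace ℝ (Fin r))
    (a : Fin r) : gradient f x a = fderiv ℝ f x (EuclideanSpace.single a 1) := by
  rw [← inner_gradient_left, EuclideanSpace.inner_single_right]
  simp

/-- Asymptotic normality of maximum likelihood type estimators: the criterion `V z` is twice
continuously differentiable, it and its Hessian near `θ₀` are dominated, its mean has the unique
maximizer `θ₀`, and the score has mean zero and satisfies the information equality. -/
theorem tendstoInDistribution_of_isMaxOn_sum {r : ℕ} {Z Ω : Type*} [MeasurableSpace Z]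
    [MeasurableSpace Ω] {P : Measure Ω} [IsProbabilityMeasure P] {ν : Measure Z}
    {Θ : Set (EuclideanSpace ℝ (Fin r))} (hΘ : IsCompact Θ)
    {θ₀ : EuclideanSpace ℝ (Fin r)} (hθ₀ : θ₀ ∈ interior Θ)
    {V : Z → EuclideanSpace ℝ (Fin r) → ℝ} (hVm : ∀ θ ∈ Θ, Measurable fun z => V z θ)
    (hVc : ∀ z, ContDiffOn ℝ 2 (V z) Θ) {B : Z → ℝ} (hB : Integrable B ν)
    (hbd : ∀ᵐ z ∂ν, ∀ θ ∈ Θ, |V z θ| ≤ B z) {U : Set (EuclideanSpace ℝ (Fin r))}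
    (hU : U ∈ 𝓝 θ₀) (hbd2 : ∀ᵐ z ∂ν, ∀ θ ∈ U, ‖fderiv ℝ (fderiv ℝ (V z)) θ‖ ≤ B z)
    (huniq : ∀ θ ∈ Θ, ∫ z, V z θ₀ ∂ν ≤ ∫ z, V z θ ∂ν → θ = θ₀)
    (hsL2 : ∀ v, MemLp (fun z => fderiv ℝ (V z) θ₀ v) 2 ν)
    (hs0 : ∀ v, ∫ z, fderiv ℝ (V z) θ₀ v ∂ν = 0)
    {J : Matrix (Fin r) (Fin r) ℝ} (hJ : IsUnit J.det)
    (hcov : ∀ a b, ∫ z, fderiv ℝ (V z) θ₀ (EuclideanSpace.single a 1) *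
      fderiv ℝ (V z) θ₀ (EuclideanSpace.single b 1) ∂ν = J a b)
    (hhess : ∀ a b, ∫ z, fderiv ℝ (fderiv ℝ (V z)) θ₀ (EuclideanSpace.single a 1)
      (EuclideanSpace.single b 1) ∂ν = - J a b)
    {W : ℕ → Ω → Z} (hlaw : ∀ i, HasLaw (W i) ν P) (hindep : iIndepFun W P)
    {θhat : ℕ → Ω → EuclideanSpace ℝ (Fin r)} (hmeas : ∀ n, AEMeasurable (θhat n) P)
    (hmax : ∀ᵐ ω ∂P, ∀ n, θhat n ω ∈ Θ ∧
      IsMaxOn (fun θ => ∑ i ∈ Finset.range n, V (W i ω) θ) Θ (θhat n ω)) :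
    TendstoInDistribution (fun (n : ℕ) ω => √(n : ℝ) • (θhat n ω - θ₀)) atTop id (fun _ => P)
      (multivariateGaussian 0 J⁻¹) := by
  have hint : interior Θ ∈ 𝓝 θ₀ := isOpen_interior.mem_nhds hθ₀
  have hVc' : ∀ z, ContDiffOn ℝ 2 (V z) (interior Θ) := fun z => (hVc z).mono interior_subset
  have hVm' : ∀ θ ∈ interior Θ, Measurable fun z => V z θ := fun θ h => hVm θ (interior_subset h)
  have hd1 : ∀ z, ∀ θ ∈ interior Θ, DifferentiableAt ℝ (V z) θ := fun z θ hθ =>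
    ((hVc' z).contDiffAt (isOpen_interior.mem_nhds hθ)).differentiableAt (by norm_num)
  have hf1 : ∀ z, ContDiffOn ℝ 1 (fderiv ℝ (V z)) (interior Θ) := fun z =>
    (hVc' z).fderiv_of_isOpen isOpen_interior (by norm_num)
  have hd2 : ∀ z, ∀ θ ∈ interior Θ, DifferentiableAt ℝ (fderiv ℝ (V z)) θ := fun z θ hθ =>
    ((hf1 z).contDiffAt (isOpen_interior.mem_nhds hθ)).differentiableAt (by norm_num)
  have hc2 : ∀ z, ContinuousOn (fderiv ℝ (fderiv ℝ (V z))) (interior Θ) := fun z =>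
    (hf1 z).continuousOn_fderiv_of_isOpen isOpen_interior (by norm_num)
  obtain ⟨ρ, hρ, hsub⟩ := Metric.nhds_basis_closedBall.mem_iff.1 (inter_mem hint hU)
  have hsm : ∀ v, Measurable fun z => fderiv ℝ (V z) θ₀ v := fun v =>
    measurable_fderiv_apply isOpen_interior hVm' hθ₀ (fun z => hd1 z θ₀ hθ₀) v
  -- consistency
  obtain ⟨hLc, hLu⟩ := uniform_strong_law hΘ hVm (fun z => (hVc z).continuousOn) hB hbd hlaw hindep
  have hcons : ∀ᵐ ω ∂P, Tendsto (fun n => θhat n ω) atTop (𝓝 θ₀) := by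
    filter_upwards [hLu, hmax] with ω h1 h2
    refine tendsto_of_isMaxOn_of_tendstoUniformlyOn hΘ hLc h1 (interior_subset hθ₀) huniq
      (fun n => (h2 n).1) (Eventually.of_forall fun n => ?_)
    intro θ hθ
    exact mul_le_mul_of_nonneg_left (isMaxOn_iff.1 (h2 n).2 θ hθ) (by positivity)
  -- uniform convergence of the Hessians
  have hHess : ∀ a b, ContinuousOn (fun θ => ∫ z, fderiv ℝ (fderiv ℝ (V z)) θ
        (EuclideanSpace.single a 1) (EuclideanSpace.single b 1) ∂ν) (Metric.closedBall θ₀ ρ) ∧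
      ∀ᵐ ω ∂P, TendstoUniformlyOn (fun (n : ℕ) θ => (n : ℝ)⁻¹ * ∑ i ∈ Finset.range n,
        fderiv ℝ (fderiv ℝ (V (W i ω))) θ (EuclideanSpace.single a 1) (EuclideanSpace.single b 1))
        (fun θ => ∫ z, fderiv ℝ (fderiv ℝ (V z)) θ (EuclideanSpace.single a 1)
          (EuclideanSpace.single b 1) ∂ν) atTop (Metric.closedBall θ₀ ρ) := by
    intro a b
    refine uniform_strong_law (f := fun z θ => fderiv ℝ (fderiv ℝ (V z)) θ
      (EuclideanSpace.single a 1) (EuclideanSpace.single b 1)) (B := B)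
      (isCompact_closedBall θ₀ ρ) (fun θ hθ =>
        measurable_fderiv_fderiv_apply isOpen_interior hVm' hVc' (hsub hθ).1 _ _)
      (fun z => (((hc2 z).mono fun θ h => (hsub h).1).clm_apply continuousOn_const).clm_apply
        continuousOn_const) hB ?_ hlaw hindep
    filter_upwards [hbd2] with z hz θ hθ
    have h1 := (fderiv ℝ (fderiv ℝ (V z)) θ).le_opNorm₂ (EuclideanSpace.single a (1 : ℝ))
      (EuclideanSpace.single b (1 : ℝ))
    simp only [PiLp.norm_single, norm_one, mul_one, Real.norm_eq_abs] at h1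
    exact h1.trans (hz θ (hsub hθ).2)
  have hHessω : ∀ᵐ ω ∂P, ∀ a b, _ := ae_all_iff.2 fun a => ae_all_iff.2 fun b => (hHess a b).2
  -- the score and its central limit theorem
  let s : Z → EuclideanSpace ℝ (Fin r) := fun z => gradient (V z) θ₀
  have hs_meas : Measurable s := by
    have : Measurable fun z => (s z).ofLp := by
      refine measurable_pi_iff.2 fun a => ?_
      simp only [s, gradient_ofLp]
      exact hsm _
    exact (PiLp.continuous_toLp 2 _).measurable.comp this
  -- The central limit theorem is applied to J⁻¹ times the score, so that its limit is already the
  -- target law.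
  let A : EuclideanSpace ℝ (Fin r) →L[ℝ] EuclideanSpace ℝ (Fin r) :=
    Matrix.toEuclideanCLM (𝕜 := ℝ) J⁻¹
  have hA : ∀ x, (A x).ofLp = J⁻¹.mulVec x.ofLp := fun x => Matrix.ofLp_toEuclideanCLM _ _
  have hJsymm : J.transpose = J := by
    ext a b
    rw [Matrix.transpose_apply, ← hcov, ← hcov]
    simp_rw [mul_comm]
  have hJisymm : J⁻¹.transpose = J⁻¹ := by rw [Matrix.transpose_nonsing_inv, hJsymm]
  have hquad : ∀ t : EuclideanSpace ℝ (Fin r),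
      ∫ z, (fderiv ℝ (V z) θ₀ t) ^ 2 ∂ν = t.ofLp ⬝ᵥ J.mulVec t.ofLp := by
    intro t
    have h1 : ∀ z, (fderiv ℝ (V z) θ₀ t) ^ 2 = ∑ a, ∑ b, t a * t b *
        (fderiv ℝ (V z) θ₀ (EuclideanSpace.single a 1) *
          fderiv ℝ (V z) θ₀ (EuclideanSpace.single b 1)) := by
      intro z
      conv_lhs => rw [euclideanSpace_eq_sum_single t, map_sum, sq, Finset.sum_mul_sum]
      refine Finset.sum_congr rfl fun a _ => Finset.sum_congr rfl fun b _ => ?_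
      simp only [map_smul, smul_eq_mul]
      ring
    have hi : ∀ a b, Integrable (fun z => t a * t b *
        (fderiv ℝ (V z) θ₀ (EuclideanSpace.single a 1) *
          fderiv ℝ (V z) θ₀ (EuclideanSpace.single b 1))) ν := fun a b =>
      ((hsL2 _).integrable_mul (hsL2 _)).const_mul _
    simp_rw [h1]
    rw [integral_finsetSum _ fun a _ => integrable_finsetSum _ fun b _ => hi a b]
    simp_rw [integral_finsetSum _ fun b _ => hi _ b, integral_const_mul, hcov]
    simp only [dotProduct, Matrix.mulVec, Finset.mul_sum]
    refine Finset.sum_congr rfl fun a _ => Finset.sum_congr rfl fun b _ => ?_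
    ring
  have hJpsd : J.PosSemidef := by
    refine Matrix.PosSemidef.of_dotProduct_mulVec_nonneg ?_ fun x => ?_
    · rw [Matrix.IsHermitian, Matrix.conjTranspose_eq_transpose_of_trivial, hJsymm]
    · have := hquad (WithLp.toLp 2 x)
      simp only [star_trivial]
      rw [← this]
      exact integral_nonneg fun _ => sq_nonneg _
  have hinner : ∀ z t, (inner ℝ (A (s z)) t : ℝ) = fderiv ℝ (V z) θ₀ (A t) := by
    intro z t
    rw [← inner_gradient_left]
    simp only [EuclideanSpace.inner_eq_star_dotProduct, hA, star_trivial, s]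
    rw [← Matrix.vecMul_transpose, hJisymm, dotProduct_comm, ← Matrix.dotProduct_mulVec,
      dotProduct_comm]
  have hAs : Measurable fun z => A (s z) := A.continuous.measurable.comp hs_meas
  have hid : ∀ i, IdentDistrib (W i) (W 0) P P := fun i =>
    ⟨(hlaw i).aemeasurable, (hlaw 0).aemeasurable, by rw [(hlaw i).map_eq, (hlaw 0).map_eq]⟩
  have hclt : TendstoInDistribution
      (fun (n : ℕ) ω => (√n)⁻¹ • ∑ i ∈ Finset.range n, A (s (W i ω))) atTop id
      (fun _ => P) (multivariateGaussian 0 J⁻¹) := by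
    refine tendstoInDistribution_multivariateGaussian (X := fun i ω => A (s (W i ω)))
      (hindep.comp (fun _ z => A (s z)) fun _ => hAs) (fun i => (hid i).comp hAs) hJpsd.inv
      (fun t => ?_) (fun t => ?_) (fun t => ?_)
    · simp_rw [hinner]
      have := hsL2 (A t)
      rw [← (hlaw 0).map_eq] at this
      exact this.comp_of_map (hlaw 0).aemeasurable
    · simp_rw [hinner]
      exact ((hlaw 0).integral_comp (f := fun z => fderiv ℝ (V z) θ₀ (A t))
        (hsm _).aestronglyMeasurable).trans (hs0 _)
    · simp_rw [hinner]
      refine ((hlaw 0).integral_comp (f := fun z => (fderiv ℝ (V z) θ₀ (A t)) ^ 2)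
        ((hsm _).pow_const 2).aestronglyMeasurable).trans ?_
      rw [hquad, hA, Matrix.mulVec_mulVec, Matrix.mul_nonsing_inv _ hJ, Matrix.one_mulVec,
        dotProduct_comm]
  -- The remainder is small only relative to √n (θ̂ - θ₀), which is not yet known to be bounded in
  -- probability; a relative error suffices.
  refine tendstoInDistribution_of_relative_error hclt
    (fun n => ((hmeas n).sub_const θ₀).fun_const_smul _) ?_
  filter_upwards [hcons, hmax, hHessω] with ω hω hmaxω hHω ε hε
  -- expansion at the maximizer
  let g : ℕ → EuclideanSpace ℝ (Fin r) → ℝ := fun n θ =>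
    (n : ℝ)⁻¹ * ∑ i ∈ Finset.range n, V (W i ω) θ
  have hg1 : ∀ n, ∀ θ ∈ interior Θ, HasFDerivAt (g n)
      ((n : ℝ)⁻¹ • ∑ i ∈ Finset.range n, fderiv ℝ (V (W i ω)) θ) θ := fun n θ hθ =>
    (HasFDerivAt.fun_sum fun i _ => (hd1 (W i ω) θ hθ).hasFDerivAt).const_mul _
  have hg2 : ∀ n, ∀ θ ∈ interior Θ, HasFDerivAt (fderiv ℝ (g n))
      ((n : ℝ)⁻¹ • ∑ i ∈ Finset.range n, fderiv ℝ (fderiv ℝ (V (W i ω))) θ) θ := fun n θ hθ => by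
    have h1 : HasFDerivAt (fun η => (n : ℝ)⁻¹ • ∑ i ∈ Finset.range n, fderiv ℝ (V (W i ω)) η)
        ((n : ℝ)⁻¹ • ∑ i ∈ Finset.range n, fderiv ℝ (fderiv ℝ (V (W i ω))) θ) θ :=
      (HasFDerivAt.fun_sum fun i _ => (hd2 (W i ω) θ hθ).hasFDerivAt).fun_const_smul _
    refine h1.congr_of_eventuallyEq ?_
    filter_upwards [isOpen_interior.mem_nhds hθ] with η hη
    exact (hg1 n η hη).fderiv
  -- Consistency eventually puts the maximizer in the interior, where it is a critical point.
  have hcrit : ∀ᶠ n in atTop, fderiv ℝ (g n) (θhat n ω) = 0 := by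
    filter_upwards [hω.eventually hint] with n hn
    refine IsLocalMax.fderiv_eq_zero (IsMaxOn.isLocalMax (s := Θ) (fun θ hθ => ?_)
      (mem_interior_iff_mem_nhds.1 hn))
    exact mul_le_mul_of_nonneg_left (isMaxOn_iff.1 (hmaxω n).2 θ hθ) (by positivity)
  have hbi : Metric.closedBall θ₀ ρ ⊆ interior Θ := fun θ h => (hsub h).1
  -- Chosen for the end of the proof: summing r coordinates and applying `A` costs a factor ‖A‖ r.
  have hε' : 0 < ε / ((‖A‖ + 1) * (r + 1)) := by positivity
  have hexp := eventually_abs_fderiv_add_sum_le hρ (g := g)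
    (fun n θ hθ => (hg2 n θ (hbi (Metric.ball_subset_closedBall hθ))).differentiableAt)
    (fun a b => (hHess a b).1)
    (fun a b => (hHω a b).congr (Eventually.of_forall fun n θ hθ => by
      simp only [(hg2 n θ (hbi hθ)).fderiv]
      simp)) hω hcrit hε'
  filter_upwards [hexp] with n hn
  set T : EuclideanSpace ℝ (Fin r) := √n • (θhat n ω - θ₀) with hT
  let R : EuclideanSpace ℝ (Fin r) := (√n)⁻¹ • ∑ i ∈ Finset.range n, s (W i ω)
  -- The remainder before inverting J: its coordinates are, up to sign, √n times the expansion
  -- errors of the gradient.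
  let D : EuclideanSpace ℝ (Fin r) := WithLp.toLp 2 (J.mulVec T.ofLp) - R
  have hAD : T - (√n)⁻¹ • ∑ i ∈ Finset.range n, A (s (W i ω)) = A D := by
    rw [← map_sum, ← map_smul, map_sub]
    congr 1
    ext b
    rw [hA, Matrix.mulVec_mulVec, Matrix.nonsing_inv_mul _ hJ, Matrix.one_mulVec]
  have hDb : ∀ b, |D b| ≤ ε / ((‖A‖ + 1) * (r + 1)) * ‖T‖ := by
    intro b
    have hsq : √(n : ℝ) * (n : ℝ)⁻¹ = (√n)⁻¹ := by
      rw [← div_eq_mul_inv, Real.sqrt_div_self', one_div]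
    have : D b = - (√n * (fderiv ℝ (g n) θ₀ (EuclideanSpace.single b 1)
        + ∑ a, (θhat n ω - θ₀) a * ∫ z, fderiv ℝ (fderiv ℝ (V z)) θ₀
        (EuclideanSpace.single a 1) (EuclideanSpace.single b 1) ∂ν)) := by
      simp only [D, R, (hg1 n θ₀ hθ₀).fderiv, hhess, hT, s]
      simp only [PiLp.sub_apply, PiLp.smul_apply, WithLp.ofLp_sum, Finset.sum_apply, gradient_ofLp,
        smul_eq_mul, Matrix.mulVec, dotProduct, smul_apply, sum_apply]
      rw [mul_add, ← mul_assoc, hsq, neg_add, Finset.mul_sum _ _ √(n : ℝ), ← Finset.sum_neg_distrib, add_comm,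
        sub_eq_add_neg]
      congr 1
      refine Finset.sum_congr rfl fun a _ => ?_
      rw [← congrFun₂ hJsymm b a, Matrix.transpose_apply]
      ring
    rw [this, abs_neg, abs_mul, abs_of_nonneg (Real.sqrt_nonneg _), hT, norm_smul,
      Real.norm_of_nonneg (Real.sqrt_nonneg _)]
    have := mul_le_mul_of_nonneg_left (hn b) (Real.sqrt_nonneg n)
    linarith
  have hDn : ‖D‖ ≤ r * (ε / ((‖A‖ + 1) * (r + 1)) * ‖T‖) := by
    rw [euclideanSpace_eq_sum_single D]
    refine (norm_sum_le _ _).trans ?_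
    refine (Finset.sum_le_sum (g := fun _ => ε / ((‖A‖ + 1) * (r + 1)) * ‖T‖)
      fun a _ => ?_).trans (by simp)
    rw [norm_smul, PiLp.norm_single, norm_one, mul_one]
    exact hDb a
  rw [hAD]
  refine (A.le_opNorm D).trans ((mul_le_mul_of_nonneg_left hDn (norm_nonneg _)).trans ?_)
  have : ‖A‖ * (r * (ε / ((‖A‖ + 1) * (r + 1)) * ‖T‖)) =
      (‖A‖ * r) / ((‖A‖ + 1) * (r + 1)) * (ε * ‖T‖) := by ring
  rw [this]
  refine mul_le_of_le_one_left (by positivity) ?_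
  rw [div_le_one (by positivity)]
  exact mul_le_mul (by linarith) (by linarith) (by positivity) (by positivity)

end MEstimation

/-! ### Differentiation under the integral from a bound on second derivatives only -/

section ParametricIntegral

variable {X E : Type*} [MeasurableSpace X] [NormedAddCommGroup E] [NormedSpace ℝ E]
  {μ : Measure X} {f : X → E → ℝ} {U : Set E} {G : X → ℝ}

theorem norm_fderiv_sub_le_of_norm_fderiv_fderiv_le {g : E → ℝ} {c δ : ℝ} {θ η : E}
    (hd : ∀ ζ ∈ Metric.ball θ δ, DifferentiableAt ℝ (fderiv ℝ g) ζ)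
    (hbd : ∀ ζ ∈ Metric.ball θ δ, ‖fderiv ℝ (fderiv ℝ g) ζ‖ ≤ c) (hη : η ∈ Metric.ball θ δ) :
    ‖fderiv ℝ g η - fderiv ℝ g θ‖ ≤ c * δ := by
  have hδ : 0 < δ := Metric.pos_of_mem_ball hη
  have hθ : θ ∈ Metric.ball θ δ := Metric.mem_ball_self hδ
  refine ((convex_ball θ δ).norm_image_sub_le_of_norm_fderiv_le hd hbd hθ hη).trans ?_
  exact mul_le_mul_of_nonneg_left (mem_ball_iff_norm.1 hη).le
    ((norm_nonneg (fderiv ℝ (fderiv ℝ g) θ)).trans (hbd θ hθ))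

/-- If the second derivative is dominated, the first derivative is integrable. -/
theorem integrable_fderiv_of_dominated (hU : IsOpen U) (hfm : ∀ θ ∈ U, Measurable fun x => f x θ)
    (hfi : ∀ θ ∈ U, Integrable (fun x => f x θ) μ) (hfc : ∀ x, ContDiffOn ℝ 2 (f x) U)
    (hG : Integrable G μ) (hbd : ∀ x, ∀ θ ∈ U, ‖fderiv ℝ (fderiv ℝ (f x)) θ‖ ≤ G x)
    {θ : E} (hθ : θ ∈ U) (v : E) : Integrable (fun x => fderiv ℝ (f x) θ v) μ := by
  obtain ⟨δ, hδ, hsub⟩ := Metric.isOpen_iff.1 hU θ hθ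
  have hd1 : ∀ x, ∀ η ∈ U, DifferentiableAt ℝ (f x) η := fun x η hη =>
    ((hfc x).contDiffAt (hU.mem_nhds hη)).differentiableAt (by norm_num)
  have hd2 : ∀ x, ∀ η ∈ U, DifferentiableAt ℝ (fderiv ℝ (f x)) η := fun x η hη =>
    (((hfc x).fderiv_of_isOpen hU (m := 1) (by norm_num)).contDiffAt
      (hU.mem_nhds hη)).differentiableAt (by norm_num)
  -- A step keeping θ + s v in the ball, also for v = 0. The derivative is then the difference
  -- quotient minus a Taylor remainder, the former integrable, the latter dominated by `G`.
  set s : ℝ := δ / (2 * (‖v‖ + 1)) with hs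
  have hs0 : 0 < s := by positivity
  have hmem : θ + s • v ∈ Metric.ball θ δ := by
    rw [mem_ball_iff_norm, add_sub_cancel_left, norm_smul, Real.norm_of_nonneg hs0.le, hs,
      div_mul_eq_mul_div, div_lt_iff₀ (by positivity)]
    nlinarith [norm_nonneg v]
  have hmeas := measurable_fderiv_apply hU hfm hθ (fun x => hd1 x θ hθ) v
  have hdom : Integrable (fun x => s⁻¹ * (|f x (θ + s • v)| + |f x θ| + G x * δ * ‖s • v‖)) μ :=
    (((hfi _ (hsub hmem)).abs.add (hfi _ hθ).abs).add ((hG.mul_const _).mul_const _)).const_mul _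
  refine hdom.mono' hmeas.aestronglyMeasurable (Eventually.of_forall fun x => ?_)
  have h1 := Convex.norm_image_sub_le_of_norm_fderiv_le' (𝕜 := ℝ) (f := f x) (C := G x * δ)
    (φ := fderiv ℝ (f x) θ) (fun η hη => hd1 x η (hsub hη))
    (fun η hη => norm_fderiv_sub_le_of_norm_fderiv_fderiv_le (fun ζ h => hd2 x ζ (hsub h))
      (fun ζ h => hbd x ζ (hsub h)) hη) (convex_ball θ δ) (Metric.mem_ball_self hδ) hmem
  rw [add_sub_cancel_left, map_smul, smul_eq_mul, Real.norm_eq_abs] at h1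
  rw [Real.norm_eq_abs, ← div_eq_inv_mul, le_div_iff₀ hs0]
  have h2 : |fderiv ℝ (f x) θ v| * s = |s * fderiv ℝ (f x) θ v| := by
    rw [abs_mul, abs_of_pos hs0, mul_comm]
  rw [h2]
  have h3 : s * fderiv ℝ (f x) θ v = f x (θ + s • v) - f x θ -
      (f x (θ + s • v) - f x θ - s * fderiv ℝ (f x) θ v) := by ring
  rw [h3]
  refine (abs_sub _ _).trans (add_le_add (abs_sub _ _) h1)

theorem hasDerivAt_add_smul (θ v : E) (t : ℝ) : HasDerivAt (fun t : ℝ => θ + t • v) v t := by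
  simpa using ((hasDerivAt_id t).smul_const v).const_add θ

/-- Differentiation under the integral sign along a line, the second derivative being dominated. -/
theorem hasDerivAt_integral_of_dominated_fderiv_fderiv (hU : IsOpen U)
    (hfm : ∀ θ ∈ U, Measurable fun x => f x θ)
    (hfi : ∀ θ ∈ U, Integrable (fun x => f x θ) μ) (hfc : ∀ x, ContDiffOn ℝ 2 (f x) U)
    (hG : Integrable G μ) (hbd : ∀ x, ∀ θ ∈ U, ‖fderiv ℝ (fderiv ℝ (f x)) θ‖ ≤ G x)
    {θ : E} (hθ : θ ∈ U) (v : E) :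
    HasDerivAt (fun t : ℝ => ∫ x, f x (θ + t • v) ∂μ) (∫ x, fderiv ℝ (f x) θ v ∂μ) 0 := by
  obtain ⟨δ, hδ, hsub⟩ := Metric.isOpen_iff.1 hU θ hθ
  have hd1 : ∀ x, ∀ η ∈ U, DifferentiableAt ℝ (f x) η := fun x η hη =>
    ((hfc x).contDiffAt (hU.mem_nhds hη)).differentiableAt (by norm_num)
  have hd2 : ∀ x, ∀ η ∈ U, DifferentiableAt ℝ (fderiv ℝ (f x)) η := fun x η hη =>
    (((hfc x).fderiv_of_isOpen hU (m := 1) (by norm_num)).contDiffAt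
      (hU.mem_nhds hη)).differentiableAt (by norm_num)
  have hs : (fun t : ℝ => θ + t • v) ⁻¹' Metric.ball θ δ ∈ 𝓝 (0 : ℝ) :=
    (hasDerivAt_add_smul θ v 0).continuousAt.preimage_mem_nhds
      (by simpa using Metric.ball_mem_nhds θ hδ)
  have h := hasDerivAt_integral_of_dominated_loc_of_deriv_le (𝕜 := ℝ) (μ := μ)
    (F := fun t x => f x (θ + t • v)) (F' := fun t x => fderiv ℝ (f x) (θ + t • v) v)
    -- Value at θ plus the variation over the ball: a dominating function for first derivatives,
    -- built from `G`.
    (bound := fun x => |fderiv ℝ (f x) θ v| + G x * δ * ‖v‖) hs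
    (by filter_upwards [hs] with t ht using (hfm _ (hsub ht)).aestronglyMeasurable)
    (by simpa using hfi θ hθ)
    (by simpa using (measurable_fderiv_apply hU hfm hθ (fun x => hd1 x θ hθ) v).aestronglyMeasurable)
    (Eventually.of_forall fun x t ht => by
      have h1 := norm_fderiv_sub_le_of_norm_fderiv_fderiv_le (fun ζ h => hd2 x ζ (hsub h))
        (fun ζ h => hbd x ζ (hsub h)) ht
      have h2 := ((fderiv ℝ (f x) (θ + t • v) - fderiv ℝ (f x) θ).le_opNorm v).trans
        (mul_le_mul_of_nonneg_right h1 (norm_nonneg v))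
      rw [sub_apply, Real.norm_eq_abs] at h2
      rw [Real.norm_eq_abs]
      linarith [abs_sub_abs_le_abs_sub (fderiv ℝ (f x) (θ + t • v) v) (fderiv ℝ (f x) θ v)])
    ((integrable_fderiv_of_dominated hU hfm hfi hfc hG hbd hθ v).abs.add
      ((hG.mul_const _).mul_const _))
    (Eventually.of_forall fun x t ht =>
      (hd1 x _ (hsub ht)).hasFDerivAt.comp_hasDerivAt t (hasDerivAt_add_smul θ v t))
  simpa using h.2

/-- Here `G` dominates directly; only integrability of the first derivative at θ comes from the
earlier difference-quotient bound. -/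
theorem hasDerivAt_integral_fderiv_of_dominated (hU : IsOpen U)
    (hfm : ∀ θ ∈ U, Measurable fun x => f x θ)
    (hfi : ∀ θ ∈ U, Integrable (fun x => f x θ) μ) (hfc : ∀ x, ContDiffOn ℝ 2 (f x) U)
    (hG : Integrable G μ) (hbd : ∀ x, ∀ θ ∈ U, ‖fderiv ℝ (fderiv ℝ (f x)) θ‖ ≤ G x)
    {θ : E} (hθ : θ ∈ U) (u v : E) :
    Integrable (fun x => fderiv ℝ (fderiv ℝ (f x)) θ u v) μ ∧
    HasDerivAt (fun t : ℝ => ∫ x, fderiv ℝ (f x) (θ + t • u) v ∂μ)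
      (∫ x, fderiv ℝ (fderiv ℝ (f x)) θ u v ∂μ) 0 := by
  have hd1 : ∀ x, ∀ η ∈ U, DifferentiableAt ℝ (f x) η := fun x η hη =>
    ((hfc x).contDiffAt (hU.mem_nhds hη)).differentiableAt (by norm_num)
  have hd2 : ∀ x, ∀ η ∈ U, DifferentiableAt ℝ (fderiv ℝ (f x)) η := fun x η hη =>
    (((hfc x).fderiv_of_isOpen hU (m := 1) (by norm_num)).contDiffAt
      (hU.mem_nhds hη)).differentiableAt (by norm_num)
  have hs : (fun t : ℝ => θ + t • u) ⁻¹' U ∈ 𝓝 (0 : ℝ) :=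
    (hasDerivAt_add_smul θ u 0).continuousAt.preimage_mem_nhds (by simpa using hU.mem_nhds hθ)
  have h := hasDerivAt_integral_of_dominated_loc_of_deriv_le (𝕜 := ℝ) (μ := μ)
    (F := fun t x => fderiv ℝ (f x) (θ + t • u) v)
    (F' := fun t x => fderiv ℝ (fderiv ℝ (f x)) (θ + t • u) u v)
    (bound := fun x => G x * ‖u‖ * ‖v‖) hs
    (by
      filter_upwards [hs] with t ht
      exact (measurable_fderiv_apply hU hfm ht (fun x => hd1 x _ ht) v).aestronglyMeasurable)
    (by simpa using integrable_fderiv_of_dominated hU hfm hfi hfc hG hbd hθ v)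
    (by simpa using (measurable_fderiv_fderiv_apply hU hfm hfc hθ u v).aestronglyMeasurable)
    (Eventually.of_forall fun x t ht => (ContinuousLinearMap.le_opNorm₂ _ u v).trans (by
      gcongr
      exact hbd x _ ht))
    ((hG.mul_const _).mul_const _)
    (Eventually.of_forall fun x t ht => by
      have h1 : HasFDerivAt (fun η => fderiv ℝ (f x) η v)
          (fderiv ℝ (fun η => fderiv ℝ (f x) η v) (θ + t • u)) (θ + t • u) :=
        ((hd2 x _ ht).clm_apply (differentiableAt_const v)).hasFDerivAt
      have h2 := h1.comp_hasDerivAt t (hasDerivAt_add_smul θ u t)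
      rwa [fderiv_fderiv_apply (hd2 x _ ht)] at h2)
  simpa using h

end ParametricIntegral

/-! ### Summing out hidden labels -/

section LabelSum

variable {m : ℕ} {A : Type*} [Fintype A] [DecidableEq A]

/-- The sum of `h` over the label sequences that agree with `y` on `S`. -/
noncomputable def labelSum (S : Finset (Fin m)) (h : (Fin m → A) → ℝ) (y : Fin m → A) : ℝ :=
  ∑ y' : Fin m → A with ∀ i ∈ S, y' i = y i, h y'

theorem labelSum_congr {S : Finset (Fin m)} (h : (Fin m → A) → ℝ) {y y' : Fin m → A}
    (hy : ∀ i ∈ S, y' i = y i) : labelSum S h y' = labelSum S h y := by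
  unfold labelSum
  congr 1
  ext z
  simp only [Finset.mem_filter, Finset.mem_univ, true_and]
  exact forall₂_congr fun i hi => by rw [hy i hi]

/-- Besides positivity, this keeps the ratio p(y) / `labelSum S p y` at most one, which dominates
the integrands below. -/
theorem le_labelSum (S : Finset (Fin m)) {h : (Fin m → A) → ℝ} (hh : ∀ y, 0 < h y)
    (y : Fin m → A) : h y ≤ labelSum S h y :=
  Finset.single_le_sum (f := h) (fun z _ => (hh z).le) (by simp)

theorem abs_labelSum_le (S : Finset (Fin m)) (h : (Fin m → A) → ℝ) (y : Fin m → A) :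
    |labelSum S h y| ≤ ∑ y', |h y'| :=
  (Finset.abs_sum_le_sum_abs _ _).trans
    (Finset.sum_le_sum_of_subset_of_nonneg (Finset.filter_subset _ _) fun _ _ _ => abs_nonneg _)

/-- Averaging a function of the revealed labels over the hidden ones. -/
theorem sum_mul_labelSum_div (S : Finset (Fin m)) {p : (Fin m → A) → ℝ} (hp : ∀ y, 0 < p y)
    (h : (Fin m → A) → ℝ) :
    ∑ y, labelSum S h y / labelSum S p y * p y = ∑ y, h y := by
  have h1 : ∀ y, labelSum S h y / labelSum S p y * p y =
      ∑ y', if ∀ i ∈ S, y' i = y i then h y' * (p y / labelSum S p y') else 0 := by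
    intro y
    rw [← Finset.sum_filter, labelSum, Finset.sum_div, Finset.sum_mul]
    refine Finset.sum_congr rfl fun y' hy' => ?_
    rw [labelSum_congr p (Finset.mem_filter.1 hy').2]
    ring
  simp_rw [h1]
  -- Agreement on `S` is symmetric and `labelSum S p` is constant on agreement classes, so after the
  -- swap the inner sum of p cancels the denominator.
  rw [Finset.sum_comm]
  refine Finset.sum_congr rfl fun y' _ => ?_
  rw [← Finset.sum_filter, ← Finset.mul_sum, ← Finset.sum_div]
  have h2 : ∑ y with ∀ i ∈ S, y' i = y i, p y = labelSum S p y' := by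
    unfold labelSum
    congr 1
    ext z
    simp [eq_comm]
  rw [h2, div_self ((hp y').trans_le (le_labelSum S hp y')).ne', mul_one]

end LabelSum

/-! ### Derivatives of logarithms and finite sums -/

section LogDerivatives

variable {E : Type*} [NormedAddCommGroup E] [NormedSpace ℝ E]

theorem fderiv_log_comp_apply {g : E → ℝ} {θ : E} (hg : DifferentiableAt ℝ g θ) (h0 : g θ ≠ 0)
    (v : E) : fderiv ℝ (fun η => Real.log (g η)) θ v = fderiv ℝ g θ v / g θ := by
  rw [fderiv.log hg h0, smul_apply, smul_eq_mul, div_eq_inv_mul]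

/-- The quotient rule, arranged for the information equality: the g''/g term will have mean zero,
leaving minus the product of scores. -/
theorem fderiv_fderiv_log_comp_apply {g : E → ℝ} {θ : E} (hg : ContDiffAt ℝ 2 g θ) (h0 : g θ ≠ 0)
    (u v : E) : fderiv ℝ (fderiv ℝ fun η => Real.log (g η)) θ u v =
      fderiv ℝ (fderiv ℝ g) θ u v / g θ -
        fderiv ℝ (fun η => Real.log (g η)) θ u * fderiv ℝ (fun η => Real.log (g η)) θ v := by
  have hd : ∀ᶠ η in 𝓝 θ, DifferentiableAt ℝ g η := by
    filter_upwards [hg.eventually (by norm_num)] with η hη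
    exact hη.differentiableAt (by norm_num)
  have hne : ∀ᶠ η in 𝓝 θ, g η ≠ 0 := hg.continuousAt.eventually_ne h0
  have hev : fderiv ℝ (fun η => Real.log (g η)) =ᶠ[𝓝 θ] fun η => (g η)⁻¹ • fderiv ℝ g η := by
    filter_upwards [hd, hne] with η h1 h2
    exact fderiv.log h1 h2
  have hd2 : DifferentiableAt ℝ (fderiv ℝ g) θ :=
    (hg.fderiv_right (m := 1) (by norm_num)).differentiableAt (by norm_num)
  have h1 : HasFDerivAt (fun η => (g η)⁻¹ • fderiv ℝ g η) _ θ :=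
    ((hasDerivAt_inv h0).comp_hasFDerivAt θ hd.self_of_nhds.hasFDerivAt).fun_smul
    hd2.hasFDerivAt
  rw [hev.fderiv_eq, h1.fderiv, fderiv_log_comp_apply hd.self_of_nhds h0,
    fderiv_log_comp_apply hd.self_of_nhds h0]
  simp
  field_simp
  ring

theorem fderiv_finsetSum_apply {ι : Type*} (s : Finset ι) {f : ι → E → ℝ} {θ : E}
    (hf : ∀ i ∈ s, DifferentiableAt ℝ (f i) θ) (v : E) :
    fderiv ℝ (fun η => ∑ i ∈ s, f i η) θ v = ∑ i ∈ s, fderiv ℝ (f i) θ v := by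
  rw [fderiv_fun_sum hf, sum_apply]

theorem fderiv_fderiv_finsetSum_apply {ι : Type*} (s : Finset ι) {f : ι → E → ℝ} {θ : E}
    (hf : ∀ i ∈ s, ContDiffAt ℝ 2 (f i) θ) (u v : E) :
    fderiv ℝ (fderiv ℝ fun η => ∑ i ∈ s, f i η) θ u v =
      ∑ i ∈ s, fderiv ℝ (fderiv ℝ (f i)) θ u v := by
  have hev : (fderiv ℝ fun η => ∑ i ∈ s, f i η) =ᶠ[𝓝 θ] fun η => ∑ i ∈ s, fderiv ℝ (f i) η := by
    have : ∀ᶠ η in 𝓝 θ, ∀ i ∈ s, DifferentiableAt ℝ (f i) η := by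
      rw [eventually_all_finset]
      intro i hi
      filter_upwards [(hf i hi).eventually (by norm_num)] with η hη
      exact hη.differentiableAt (by norm_num)
    filter_upwards [this] with η hη
    exact fderiv_fun_sum hη
  rw [hev.fderiv_eq, fderiv_fun_sum fun i hi =>
    ((hf i hi).fderiv_right (m := 1) (by norm_num)).differentiableAt (by norm_num)]
  simp

end LogDerivatives

/-! ### The model at a fixed length -/

namespace SeqModel

variable {r : ℕ} {A : Type*} [Fintype A]
  {𝒳 : ℕ → Type*} [∀ m, MeasurableSpace (𝒳 m)] {Θ : Set (EuclideanSpace ℝ (Fin r))}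
  (M : SeqModel r A 𝒳 Θ) {m : ℕ} {θ : EuclideanSpace ℝ (Fin r)}

theorem partialDensity_pos [DecidableEq A] (S : Finset (Fin m)) (hθ : θ ∈ Θ) (x : 𝒳 m) (y : Fin m → A) :
    0 < M.partialDensity m S θ x y :=
  (M.density_pos m θ hθ x y).trans_le (le_labelSum S (M.density_pos m θ hθ x) y)

theorem integrable_density (hθ : θ ∈ Θ) (y : Fin m → A) :
    Integrable (fun x => M.density m θ x y) (M.base m) := by
  refine (lintegral_ofReal_ne_top_iff_integrable
    (M.measurable_density m θ hθ y).aestronglyMeasurable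
    (Eventually.of_forall fun x => (M.density_pos m θ hθ x y).le)).1 ?_
  refine ((Finset.single_le_sum (f := fun y => ∫⁻ x, ENNReal.ofReal (M.density m θ x y) ∂(M.base m))
    (fun _ _ => zero_le) (Finset.mem_univ y)).trans_lt ?_).ne
  rw [M.lintegral_density m θ hθ]
  exact ENNReal.one_lt_top

theorem sum_integral_density (m : ℕ) (hθ : θ ∈ Θ) :
    ∑ y : Fin m → A, ∫ x, M.density m θ x y ∂(M.base m) = 1 := by
  have h1 : ∀ y : Fin m → A, ENNReal.ofReal (∫ x, M.density m θ x y ∂(M.base m)) =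
      ∫⁻ x, ENNReal.ofReal (M.density m θ x y) ∂(M.base m) := fun y =>
    ofReal_integral_eq_lintegral_ofReal (M.integrable_density hθ y)
      (Eventually.of_forall fun x => (M.density_pos m θ hθ x y).le)
  have h2 := M.lintegral_density m θ hθ
  simp_rw [← h1] at h2
  rw [← ENNReal.ofReal_sum_of_nonneg fun y _ =>
    integral_nonneg fun x => (M.density_pos m θ hθ x y).le] at h2
  rwa [ENNReal.ofReal_eq_one] at h2

variable [MeasurableSpace A] [DiscreteMeasurableSpace A]

theorem measurable_uncurry_density (hθ : θ ∈ Θ) :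
    Measurable fun z : 𝒳 m × (Fin m → A) => M.density m θ z.1 z.2 :=
  measurable_from_prod_countable_left fun y => M.measurable_density m θ hθ y

/-- Slicing by label sequence reduces integrals over (x, y) to finite sums of integrals over the
base measure. -/
theorem count_prod_eq_sum (m : ℕ) :
    (M.base m).prod (Measure.count : Measure (Fin m → A)) =
      Measure.sum fun y => (M.base m).map fun x => (x, y) := by
  have := M.sigmaFinite_base m
  ext s hs
  rw [Measure.prod_apply_symm hs, lintegral_count, tsum_fintype, Measure.sum_apply _ hs,
    tsum_fintype]
  exact Finset.sum_congr rfl fun y _ => (Measure.map_apply measurable_prodMk_right hs).symm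

theorem integrable_lawOfLength_iff (hθ : θ ∈ Θ) {f : 𝒳 m × (Fin m → A) → ℝ} (hf : Measurable f) :
    Integrable f (M.lawOfLength θ m) ↔
      ∀ y, Integrable (fun x => f (x, y) * M.density m θ x y) (M.base m) := by
  have hd := M.measurable_uncurry_density (m := m) hθ
  have hfd : Measurable fun z : 𝒳 m × (Fin m → A) =>
      f z * (ENNReal.ofReal (M.density m θ z.1 z.2)).toReal := hf.mul hd.ennreal_ofReal.ennreal_toReal
  rw [lawOfLength, integrable_withDensity_iff hd.ennreal_ofReal
    (Eventually.of_forall fun _ => ENNReal.ofReal_lt_top), count_prod_eq_sum,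
    integrable_sum_measure_iff]
  simp_rw [integrable_map_measure hfd.aestronglyMeasurable measurable_prodMk_right.aemeasurable]
  simp only [Function.comp_def, ENNReal.toReal_ofReal (M.density_pos m θ hθ _ _).le]
  exact ⟨fun h => h.1, fun h => ⟨h, Summable.of_finite⟩⟩

theorem integral_lawOfLength (hθ : θ ∈ Θ) {f : 𝒳 m × (Fin m → A) → ℝ} (hf : Measurable f)
    (hfi : Integrable f (M.lawOfLength θ m)) :
    ∫ z, f z ∂(M.lawOfLength θ m) = ∑ y, ∫ x, f (x, y) * M.density m θ x y ∂(M.base m) := by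
  have hd := M.measurable_uncurry_density (m := m) hθ
  have hfd : Measurable fun z : 𝒳 m × (Fin m → A) =>
      f z * (ENNReal.ofReal (M.density m θ z.1 z.2)).toReal := hf.mul hd.ennreal_ofReal.ennreal_toReal
  rw [lawOfLength, integrable_withDensity_iff hd.ennreal_ofReal
    (Eventually.of_forall fun _ => ENNReal.ofReal_lt_top), count_prod_eq_sum] at hfi
  rw [lawOfLength, integral_withDensity_eq_integral_toReal_smul hd.ennreal_ofReal
    (Eventually.of_forall fun _ => ENNReal.ofReal_lt_top), count_prod_eq_sum]
  simp_rw [smul_eq_mul, mul_comm _ (f _)]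
  rw [integral_sum_measure hfi, tsum_fintype]
  refine Finset.sum_congr rfl fun y _ => ?_
  rw [integral_map measurable_prodMk_right.aemeasurable hfd.aestronglyMeasurable]
  simp only [ENNReal.toReal_ofReal (M.density_pos m θ hθ _ _).le]

/-- Positivity of the density makes null sets of the model law null for the base measure on every
slice. -/
theorem ae_of_ae_lawOfLength (hθ : θ ∈ Θ) {Q : 𝒳 m × (Fin m → A) → Prop}
    (hQ : ∀ᵐ z ∂(M.lawOfLength θ m), Q z) (y : Fin m → A) : ∀ᵐ x ∂(M.base m), Q (x, y) := by
  have hd := M.measurable_uncurry_density (m := m) hθ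
  rw [lawOfLength, ae_withDensity_iff hd.ennreal_ofReal, count_prod_eq_sum,
    Measure.ae_sum_iff] at hQ
  filter_upwards [ae_of_ae_map measurable_prodMk_right.aemeasurable (hQ y)] with x hx
  exact hx (by simpa using M.density_pos m θ hθ x y)

theorem isProbabilityMeasure_lawOfLength (hθ : θ ∈ Θ) (m : ℕ) :
    IsProbabilityMeasure (M.lawOfLength θ m) := by
  have hd := M.measurable_uncurry_density (m := m) hθ
  refine ⟨?_⟩
  rw [lawOfLength, withDensity_apply _ .univ, setLIntegral_univ, count_prod_eq_sum,
    lintegral_sum_measure, tsum_fintype, ← M.lintegral_density m θ hθ]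
  exact Finset.sum_congr rfl fun y _ => lintegral_map hd.ennreal_ofReal measurable_prodMk_right

end SeqModel

/-! ### Likelihood ratios and scores of partial data at a fixed length -/

namespace SeqModel

variable {r : ℕ} {A : Type*} [Fintype A]
  {𝒳 : ℕ → Type*} [∀ m, MeasurableSpace (𝒳 m)] {Θ : Set (EuclideanSpace ℝ (Fin r))}
  (M : SeqModel r A 𝒳 Θ) {m : ℕ} {θ : EuclideanSpace ℝ (Fin r)}
  {U : Set (EuclideanSpace ℝ (Fin r))}

section Derivatives

/-- The total mass is constantly 1 along the line θ + t v near t = 0, so its derivative vanishes. -/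
theorem sum_integral_fderiv_density (hU : IsOpen U) (hUΘ : U ⊆ Θ)
    (hsm : ∀ x y, ContDiffOn ℝ 2 (fun η => M.density m η x y) U)
    (hdom : ∀ y, ∃ G : 𝒳 m → ℝ, Integrable G (M.base m) ∧
      ∀ θ ∈ U, ∀ x, ‖fderiv ℝ (fderiv ℝ fun η => M.density m η x y) θ‖ ≤ G x)
    (hθ : θ ∈ U) (v : EuclideanSpace ℝ (Fin r)) :
    (∀ y, Integrable (fun x => fderiv ℝ (fun η => M.density m η x y) θ v) (M.base m)) ∧
      ∑ y, ∫ x, fderiv ℝ (fun η => M.density m η x y) θ v ∂(M.base m) = 0 := by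
  choose G hG hbd using hdom
  refine ⟨fun y => integrable_fderiv_of_dominated hU
    (fun θ h => M.measurable_density m θ (hUΘ h) y)
    (fun θ h => M.integrable_density (hUΘ h) y) (fun x => hsm x y) (hG y)
    (fun x θ h => hbd y θ h x) hθ v, ?_⟩
  have h1 := HasDerivAt.fun_sum (u := Finset.univ) fun y _ =>
    hasDerivAt_integral_of_dominated_fderiv_fderiv hU
    (fun θ h => M.measurable_density m θ (hUΘ h) y)
    (fun θ h => M.integrable_density (hUΘ h) y) (fun x => hsm x y) (hG y)
    (fun x θ h => hbd y θ h x) hθ v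
  refine h1.unique ((hasDerivAt_const (0 : ℝ) (1 : ℝ)).congr_of_eventuallyEq ?_)
  have hs : (fun t : ℝ => θ + t • v) ⁻¹' U ∈ 𝓝 (0 : ℝ) :=
    (hasDerivAt_add_smul θ v 0).continuousAt.preimage_mem_nhds (by simpa using hU.mem_nhds hθ)
  filter_upwards [hs] with t ht
  exact M.sum_integral_density m (hUΘ ht)

/-- The first-order identity holds at every point of the open set `U`, hence can itself be
differentiated. -/
theorem sum_integral_fderiv_fderiv_density (hU : IsOpen U) (hUΘ : U ⊆ Θ)
    (hsm : ∀ x y, ContDiffOn ℝ 2 (fun η => M.density m η x y) U)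
    (hdom : ∀ y, ∃ G : 𝒳 m → ℝ, Integrable G (M.base m) ∧
      ∀ θ ∈ U, ∀ x, ‖fderiv ℝ (fderiv ℝ fun η => M.density m η x y) θ‖ ≤ G x)
    (hθ : θ ∈ U) (u v : EuclideanSpace ℝ (Fin r)) :
    (∀ y, Integrable (fun x => fderiv ℝ (fderiv ℝ fun η => M.density m η x y) θ u v)
      (M.base m)) ∧
      ∑ y, ∫ x, fderiv ℝ (fderiv ℝ fun η => M.density m η x y) θ u v ∂(M.base m) = 0 := by
  have hdom' := hdom
  choose G hG hbd using hdom
  have h0 := fun y => hasDerivAt_integral_fderiv_of_dominated hU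
    (fun θ h => M.measurable_density m θ (hUΘ h) y)
    (fun θ h => M.integrable_density (hUΘ h) y) (fun x => hsm x y) (hG y)
    (fun x θ h => hbd y θ h x) hθ u v
  refine ⟨fun y => (h0 y).1, ?_⟩
  have h1 := HasDerivAt.fun_sum (u := Finset.univ) fun y _ => (h0 y).2
  refine h1.unique ((hasDerivAt_const (0 : ℝ) (0 : ℝ)).congr_of_eventuallyEq ?_)
  have hs : (fun t : ℝ => θ + t • u) ⁻¹' U ∈ 𝓝 (0 : ℝ) :=
    (hasDerivAt_add_smul θ u 0).continuousAt.preimage_mem_nhds (by simpa using hU.mem_nhds hθ)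
  filter_upwards [hs] with t ht
  exact (M.sum_integral_fderiv_density hU hUΘ hsm hdom' ht v).2

variable [DecidableEq A]

theorem contDiffOn_partialDensity {U : Set (EuclideanSpace ℝ (Fin r))}
    (hsm : ∀ x y, ContDiffOn ℝ 2 (fun η => M.density m η x y) U) (S : Finset (Fin m)) (x : 𝒳 m)
    (y : Fin m → A) : ContDiffOn ℝ 2 (fun η => M.partialDensity m S η x y) U :=
  ContDiffOn.sum fun y' _ => hsm x y'

theorem contDiffOn_logPartial (hUΘ : U ⊆ Θ)
    (hsm : ∀ x y, ContDiffOn ℝ 2 (fun η => M.density m η x y) U) (S : Finset (Fin m))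
    (z : 𝒳 m × (Fin m → A)) : ContDiffOn ℝ 2 (M.logPartial m S z) U :=
  (M.contDiffOn_partialDensity hsm S z.1 z.2).log fun _ h =>
    (M.partialDensity_pos S (hUΘ h) _ _).ne'

theorem fderiv_logPartial_apply (hU : IsOpen U) (hUΘ : U ⊆ Θ)
    (hsm : ∀ x y, ContDiffOn ℝ 2 (fun η => M.density m η x y) U) (hθ : θ ∈ U)
    (S : Finset (Fin m)) (z : 𝒳 m × (Fin m → A)) (v : EuclideanSpace ℝ (Fin r)) :
    fderiv ℝ (M.logPartial m S z) θ v =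
      labelSum S (fun y => fderiv ℝ (fun η => M.density m η z.1 y) θ v) z.2 /
        labelSum S (M.density m θ z.1) z.2 := by
  have h := fderiv_log_comp_apply (((M.contDiffOn_partialDensity hsm S z.1 z.2).contDiffAt
    (hU.mem_nhds hθ)).differentiableAt (by norm_num)) (M.partialDensity_pos S (hUΘ hθ) _ _).ne' v
  refine h.trans ?_
  congr 1
  exact fderiv_finsetSum_apply _ (fun y _ => ((hsm z.1 y).contDiffAt
    (hU.mem_nhds hθ)).differentiableAt (by norm_num)) v

theorem fderiv_fderiv_logPartial_apply (hU : IsOpen U) (hUΘ : U ⊆ Θ)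
    (hsm : ∀ x y, ContDiffOn ℝ 2 (fun η => M.density m η x y) U) (hθ : θ ∈ U)
    (S : Finset (Fin m)) (z : 𝒳 m × (Fin m → A)) (u v : EuclideanSpace ℝ (Fin r)) :
    fderiv ℝ (fderiv ℝ (M.logPartial m S z)) θ u v =
      labelSum S (fun y => fderiv ℝ (fderiv ℝ fun η => M.density m η z.1 y) θ u v) z.2 /
        labelSum S (M.density m θ z.1) z.2 -
      fderiv ℝ (M.logPartial m S z) θ u * fderiv ℝ (M.logPartial m S z) θ v := by
  have h := fderiv_fderiv_log_comp_apply ((M.contDiffOn_partialDensity hsm S z.1 z.2).contDiffAt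
    (hU.mem_nhds hθ)) (M.partialDensity_pos S (hUΘ hθ) _ _).ne' u v
  refine h.trans ?_
  congr 2
  exact fderiv_fderiv_finsetSum_apply _ (fun y _ => (hsm z.1 y).contDiffAt (hU.mem_nhds hθ)) u v

end Derivatives

variable [DecidableEq A] [MeasurableSpace A] [DiscreteMeasurableSpace A]

theorem measurable_labelSum (S : Finset (Fin m)) {h : 𝒳 m → (Fin m → A) → ℝ}
    (hh : ∀ y, Measurable fun x => h x y) :
    Measurable fun z : 𝒳 m × (Fin m → A) => labelSum S (h z.1) z.2 :=
  measurable_from_prod_countable_left fun _ => by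
    simp only [labelSum]
    exact Finset.measurable_fun_sum _ fun y' _ => hh y'

theorem measurable_logPartial (S : Finset (Fin m)) (hθ : θ ∈ Θ) :
    Measurable fun z : 𝒳 m × (Fin m → A) => M.logPartial m S z θ :=
  (measurable_labelSum S fun y => M.measurable_density m θ hθ y).log

/-- Averaging over the hidden labels, for a function of the observation and the revealed labels. -/
theorem integral_labelSum_div (S : Finset (Fin m)) (hθ : θ ∈ Θ) {h : 𝒳 m → (Fin m → A) → ℝ}
    (hm : ∀ y, Measurable fun x => h x y)
    (hi : ∀ y, Integrable (fun x => h x y) (M.base m)) :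
    Integrable (fun z => labelSum S (h z.1) z.2 / labelSum S (M.density m θ z.1) z.2)
      (M.lawOfLength θ m) ∧
    ∫ z, labelSum S (h z.1) z.2 / labelSum S (M.density m θ z.1) z.2 ∂(M.lawOfLength θ m) =
      ∑ y, ∫ x, h x y ∂(M.base m) := by
  have hmeas : Measurable fun z : 𝒳 m × (Fin m → A) =>
      labelSum S (h z.1) z.2 / labelSum S (M.density m θ z.1) z.2 :=
    (measurable_labelSum S hm).div (measurable_labelSum S fun y => M.measurable_density m θ hθ y)
  have hint : ∀ y, Integrable (fun x => labelSum S (h x) y / labelSum S (M.density m θ x) y *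
      M.density m θ x y) (M.base m) := by
    intro y
    -- Since p(y) ≤ `labelSum S p y`, the weighted ratio is at most the full sum of |h|.
    have hdom : Integrable (fun x => ∑ y', |h x y'|) (M.base m) :=
      integrable_finsetSum _ fun y' _ => (hi y').abs
    refine hdom.mono' ((hmeas.comp measurable_prodMk_right).mul
      (M.measurable_density m θ hθ y)).aestronglyMeasurable (Eventually.of_forall fun x => ?_)
    have hp := M.density_pos m θ hθ x
    have hle := le_labelSum S hp y
    rw [Real.norm_eq_abs, abs_mul, abs_div, abs_of_pos (hp y), abs_of_pos ((hp y).trans_le hle),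
      div_mul_eq_mul_div, div_le_iff₀ ((hp y).trans_le hle)]
    exact mul_le_mul (abs_labelSum_le S _ y) hle (hp y).le
      (Finset.sum_nonneg fun _ _ => abs_nonneg _)
  have hI := (M.integrable_lawOfLength_iff hθ hmeas).2 hint
  refine ⟨hI, ?_⟩
  rw [M.integral_lawOfLength hθ hmeas hI, ← integral_finsetSum _ fun y _ => hint y,
    ← integral_finsetSum _ fun y _ => hi y]
  exact integral_congr_ae (Eventually.of_forall fun x =>
    sum_mul_labelSum_div S (M.density_pos m θ hθ x) (h x))

/-- The likelihood ratio of the partial data has mean one. -/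
theorem integral_exp_logPartial_sub {η : EuclideanSpace ℝ (Fin r)} (hθ : θ ∈ Θ) (hη : η ∈ Θ)
    (S : Finset (Fin m)) :
    Integrable (fun z => Real.exp (M.logPartial m S z η - M.logPartial m S z θ))
      (M.lawOfLength θ m) ∧
    ∫ z, Real.exp (M.logPartial m S z η - M.logPartial m S z θ) ∂(M.lawOfLength θ m) = 1 := by
  have h := M.integral_labelSum_div S hθ (h := M.density m η)
    (fun y => M.measurable_density m η hη y) (fun y => M.integrable_density hη y)
  rw [M.sum_integral_density m hη] at h
  have he : ∀ z : 𝒳 m × (Fin m → A), Real.exp (M.logPartial m S z η - M.logPartial m S z θ) =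
      labelSum S (M.density m η z.1) z.2 / labelSum S (M.density m θ z.1) z.2 := fun z => by
    rw [Real.exp_sub, logPartial, logPartial, Real.exp_log (M.partialDensity_pos S hη _ _),
      Real.exp_log (M.partialDensity_pos S hθ _ _)]
    rfl
  simp_rw [he]
  exact h

theorem measurable_fderiv_logPartial_apply (hU : IsOpen U) (hUΘ : U ⊆ Θ)
    (hsm : ∀ x y, ContDiffOn ℝ 2 (fun η => M.density m η x y) U) (hθ : θ ∈ U)
    (S : Finset (Fin m)) (v : EuclideanSpace ℝ (Fin r)) :
    Measurable fun z : 𝒳 m × (Fin m → A) => fderiv ℝ (M.logPartial m S z) θ v :=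
  measurable_fderiv_apply hU (fun _ h => M.measurable_logPartial S (hUΘ h)) hθ
    (fun z => ((M.contDiffOn_logPartial hUΘ hsm S z).contDiffAt
      (hU.mem_nhds hθ)).differentiableAt (by norm_num)) v

/-- Mean, integrability and information equality for the score of the partial data. -/
theorem integral_fderiv_logPartial_mul (hU : IsOpen U) (hUΘ : U ⊆ Θ)
    (hsm : ∀ x y, ContDiffOn ℝ 2 (fun η => M.density m η x y) U)
    (hdom : ∀ y, ∃ G : 𝒳 m → ℝ, Integrable G (M.base m) ∧
      ∀ θ ∈ U, ∀ x, ‖fderiv ℝ (fderiv ℝ fun η => M.density m η x y) θ‖ ≤ G x)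
    (hθ : θ ∈ U) (S : Finset (Fin m))
    (hH : ∀ u v, Integrable (fun z => fderiv ℝ (fderiv ℝ (M.logPartial m S z)) θ u v)
      (M.lawOfLength θ m)) :
    (∀ v, MemLp (fun z => fderiv ℝ (M.logPartial m S z) θ v) 2 (M.lawOfLength θ m)) ∧
    (∀ v, ∫ z, fderiv ℝ (M.logPartial m S z) θ v ∂(M.lawOfLength θ m) = 0) ∧
    (∀ u v, ∫ z, fderiv ℝ (M.logPartial m S z) θ u * fderiv ℝ (M.logPartial m S z) θ v
      ∂(M.lawOfLength θ m) =
      - ∫ z, fderiv ℝ (fderiv ℝ (M.logPartial m S z)) θ u v ∂(M.lawOfLength θ m)) := by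
  have hfm := fun y => fun θ (h : θ ∈ U) => M.measurable_density m θ (hUΘ h) y
  have h1 := fun v => M.integral_labelSum_div S (hUΘ hθ)
    (h := fun x y => fderiv ℝ (fun η => M.density m η x y) θ v)
    (fun y => measurable_fderiv_apply hU (hfm y) hθ (fun x => ((hsm x y).contDiffAt
      (hU.mem_nhds hθ)).differentiableAt (by norm_num)) v)
    (M.sum_integral_fderiv_density hU hUΘ hsm hdom hθ v).1
  have h2 := fun u v => M.integral_labelSum_div S (hUΘ hθ)
    (h := fun x y => fderiv ℝ (fderiv ℝ fun η => M.density m η x y) θ u v)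
    (fun y => measurable_fderiv_fderiv_apply hU (hfm y) (fun x => hsm x y) hθ u v)
    (M.sum_integral_fderiv_fderiv_density hU hUΘ hsm hdom hθ u v).1
  -- Products of scores are a difference of two integrable functions, so square integrability needs
  -- no separate moment assumption.
  have hprod : ∀ (z : 𝒳 m × (Fin m → A)) u v,
      fderiv ℝ (M.logPartial m S z) θ u * fderiv ℝ (M.logPartial m S z) θ v =
      labelSum S (fun y => fderiv ℝ (fderiv ℝ fun η => M.density m η z.1 y) θ u v) z.2 /
        labelSum S (M.density m θ z.1) z.2 -
      fderiv ℝ (fderiv ℝ (M.logPartial m S z)) θ u v := fun z u v => by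
    rw [M.fderiv_fderiv_logPartial_apply hU hUΘ hsm hθ]
    ring
  refine ⟨fun v => ?_, fun v => ?_, fun u v => ?_⟩
  · rw [memLp_two_iff_integrable_sq
      (M.measurable_fderiv_logPartial_apply hU hUΘ hsm hθ S v).aestronglyMeasurable]
    simp_rw [sq, hprod]
    exact (h2 v v).1.sub (hH v v)
  · simp_rw [M.fderiv_logPartial_apply hU hUΘ hsm hθ]
    rw [(h1 v).2, (M.sum_integral_fderiv_density hU hUΘ hsm hdom hθ v).2]
  · simp_rw [hprod]
    rw [integral_sub (h2 u v).1 (hH u v), (h2 u v).2,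
      (M.sum_integral_fderiv_fderiv_density hU hUΘ hsm hdom hθ u v).2, zero_sub]

end SeqModel

/-! ### Mixing over lengths and labelling draws -/

instance isFiniteMeasure_policyLaw {k : ℕ} (lam : Fin k → ℝ) : IsFiniteMeasure (policyLaw lam) := by
  refine ⟨?_⟩
  rw [policyLaw, Measure.finsetSum_apply]
  exact ENNReal.sum_lt_top.2 fun j _ => by simp

theorem measurable_sigma_mk {𝒴 : ℕ → Type*} [∀ m, MeasurableSpace (𝒴 m)] (m : ℕ) :
    Measurable (Sigma.mk m : 𝒴 m → Σ m, 𝒴 m) := fun _ hs =>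
  MeasurableSpace.measurableSet_iInf.1 hs m

theorem measurable_of_sigma {𝒴 : ℕ → Type*} [∀ m, MeasurableSpace (𝒴 m)] {β : Type*}
    [MeasurableSpace β] {f : (Σ m, 𝒴 m) → β} (hf : ∀ m, Measurable fun y => f ⟨m, y⟩) :
    Measurable f := fun _ hs =>
  MeasurableSpace.measurableSet_iInf.2 fun m => hf m hs

namespace SeqModel

variable {r k : ℕ} {A : Type*} [MeasurableSpace A]
  {𝒳 : ℕ → Type*} [∀ m, MeasurableSpace (𝒳 m)] {Θ : Set (EuclideanSpace ℝ (Fin r))}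
  (q : PMF ℕ) {lam : Fin k → ℝ} {θ : EuclideanSpace ℝ (Fin r)}

theorem measurable_of_seqData {β : Type*} [MeasurableSpace β] {f : SeqData A 𝒳 × Fin k → β}
    (hf : ∀ m j, Measurable fun z => f (⟨m, z⟩, j)) : Measurable f :=
  measurable_from_prod_countable_left fun j => measurable_of_sigma fun m => hf m j

theorem measurable_mk_mk (m : ℕ) (j : Fin k) :
    Measurable fun z : 𝒳 m × (Fin m → A) => ((⟨m, z⟩, j) : SeqData A 𝒳 × Fin k) :=
  (measurable_sigma_mk m).prodMk measurable_const

variable [Fintype A] (M : SeqModel r A 𝒳 Θ) [DiscreteMeasurableSpace A]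

/-- Length m and draw j occur with weight q(m) λⱼ; this reduces statements about the full data law
to fixed-length ones. -/
theorem law_prod_policyLaw (hθ : θ ∈ Θ) (lam : Fin k → ℝ) :
    (M.law q θ).prod (policyLaw lam) = Measure.sum fun m => q m • ∑ j, ENNReal.ofReal (lam j) •
      (M.lawOfLength θ m).map fun z => ((⟨m, z⟩, j) : SeqData A 𝒳 × Fin k) := by
  have hp := M.isProbabilityMeasure_lawOfLength hθ
  have : SFinite (M.law q θ) := by unfold law; infer_instance
  ext s hs
  rw [Measure.prod_apply_symm hs, policyLaw, lintegral_finsetSum_measure, Measure.sum_apply _ hs]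
  simp only [lintegral_smul_measure, lintegral_dirac, Measure.smul_apply, smul_eq_mul,
    Measure.finsetSum_apply, law]
  simp_rw [fun j : Fin k => Measure.sum_apply
    (fun m => q m • (M.lawOfLength θ m).map (Sigma.mk m)) (measurable_prodMk_right (y := j) hs)]
  simp only [Measure.smul_apply, smul_eq_mul]
  simp_rw [fun j : Fin k => fun m => Measure.map_apply (μ := M.lawOfLength θ m)
    (measurable_sigma_mk m) (measurable_prodMk_right (y := j) hs),
    fun j : Fin k => fun m => Measure.map_apply (μ := M.lawOfLength θ m)
    (measurable_mk_mk m j) hs, ← ENNReal.tsum_mul_left, Finset.mul_sum]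
  rw [← Summable.tsum_finsetSum fun _ _ => ENNReal.summable]
  refine tsum_congr fun m => Finset.sum_congr rfl fun j _ => ?_
  rw [mul_left_comm]
  rfl

theorem lintegral_law_prod_policyLaw (hθ : θ ∈ Θ) (lam : Fin k → ℝ)
    {f : SeqData A 𝒳 × Fin k → ℝ≥0∞} (hf : Measurable f) :
    ∫⁻ w, f w ∂(M.law q θ).prod (policyLaw lam) = ∑' m, q m * ∑ j, ENNReal.ofReal (lam j) *
      ∫⁻ z, f (⟨m, z⟩, j) ∂(M.lawOfLength θ m) := by
  rw [M.law_prod_policyLaw q hθ, lintegral_sum_measure]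
  simp_rw [lintegral_smul_measure, lintegral_finsetSum_measure, lintegral_smul_measure,
    lintegral_map hf (measurable_mk_mk _ _), smul_eq_mul]

/-- A component of positive weight is absolutely continuous with respect to the mixture. -/
theorem ae_lawOfLength_of_ae (hlam : ∀ j, 0 < lam j) (hθ : θ ∈ Θ) {Q : SeqData A 𝒳 × Fin k → Prop}
    (h : ∀ᵐ w ∂(M.law q θ).prod (policyLaw lam), Q w) {m : ℕ} (hm : q m ≠ 0) (j : Fin k) :
    ∀ᵐ z ∂(M.lawOfLength θ m), Q (⟨m, z⟩, j) := by
  rw [M.law_prod_policyLaw q hθ, Measure.ae_sum_iff] at h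
  have h1 := (Measure.ae_ennreal_smul_measure_iff hm).1 (h m)
  rw [← Measure.sum_fintype, Measure.ae_sum_iff] at h1
  have h2 := (Measure.ae_ennreal_smul_measure_iff (ENNReal.ofReal_pos.2 (hlam j)).ne').1 (h1 j)
  exact ae_of_ae_map (measurable_mk_mk m j).aemeasurable h2

theorem integrable_lawOfLength_of_integrable (hlam : ∀ j, 0 < lam j) (hθ : θ ∈ Θ) {f : SeqData A 𝒳 × Fin k → ℝ}
    (h : Integrable f ((M.law q θ).prod (policyLaw lam))) {m : ℕ} (hm : q m ≠ 0) (j : Fin k) :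
    Integrable f ((M.lawOfLength θ m).map fun z => (⟨m, z⟩, j)) := by
  rw [M.law_prod_policyLaw q hθ] at h
  have h1 := (integrable_smul_measure hm (q.apply_ne_top m)).1 (h.mono_measure (Measure.le_sum _ m))
  exact (integrable_smul_measure (ENNReal.ofReal_pos.2 (hlam j)).ne' ENNReal.ofReal_ne_top).1
    (integrable_finsetSum_measure.1 h1 j (Finset.mem_univ j))

theorem hasSum_integral_lawOfLength (hlam : ∀ j, 0 < lam j) (hθ : θ ∈ Θ) {f : SeqData A 𝒳 × Fin k → ℝ}
    (h : Integrable f ((M.law q θ).prod (policyLaw lam))) :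
    HasSum (fun m => (q m).toReal * ∑ j, lam j * ∫ z, f (⟨m, z⟩, j) ∂(M.lawOfLength θ m))
      (∫ w, f w ∂(M.law q θ).prod (policyLaw lam)) := by
  have hi := fun m (hm : q m ≠ 0) j => M.integrable_lawOfLength_of_integrable q hlam hθ h hm j
  rw [M.law_prod_policyLaw q hθ] at h ⊢
  convert hasSum_integral_measure h using 1
  · rfl
  ext m
  rw [integral_smul_measure, smul_eq_mul]
  by_cases hm : q m = 0
  · simp [hm]
  · rw [integral_finsetSum_measure fun j _ => (hi m hm j).smul_measure ENNReal.ofReal_ne_top]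
    congr 1
    refine Finset.sum_congr rfl fun j _ => ?_
    rw [integral_smul_measure, ENNReal.toReal_ofReal (hlam j).le, smul_eq_mul,
      integral_map (measurable_mk_mk m j).aemeasurable (hi m hm j).aestronglyMeasurable]

/-- Lets bounds assumed only at lengths of positive probability serve as almost sure bounds. -/
theorem ae_length_ne_zero (hθ : θ ∈ Θ) (lam : Fin k → ℝ) :
    ∀ᵐ w ∂(M.law q θ).prod (policyLaw lam), q w.1.1 ≠ 0 := by
  have hm : Measurable fun w : SeqData A 𝒳 × Fin k => 
      Set.indicator {m | q m = 0} (1 : ℕ → ℝ≥0∞) w.1.1 :=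
    measurable_of_seqData fun m _ =>
      measurable_const (a := Set.indicator {m | q m = 0} (1 : ℕ → ℝ≥0∞) m)
  have h := M.lintegral_law_prod_policyLaw q hθ lam
    (f := fun w => Set.indicator {m | q m = 0} (1 : ℕ → ℝ≥0∞) w.1.1) hm
  have h0 : ∑' m, q m * ∑ j, ENNReal.ofReal (lam j) *
      ∫⁻ z, Set.indicator {m | q m = 0} (1 : ℕ → ℝ≥0∞) m ∂(M.lawOfLength θ m) = 0 := by
    refine ENNReal.tsum_eq_zero.2 fun m => ?_
    by_cases hm : q m = 0 <;> simp [hm]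
  rw [h0, lintegral_eq_zero_iff hm] at h
  filter_upwards [h] with w hw hq
  simp [hq] at hw

end SeqModel

/-! ### Uniqueness of the maximizer of the mean log-likelihood -/

namespace SeqModel

variable {r k : ℕ} {A : Type*} [Fintype A] [DecidableEq A] {𝒳 : ℕ → Type*} [∀ m, MeasurableSpace (𝒳 m)]
  {Θ : Set (EuclideanSpace ℝ (Fin r))} (M : SeqModel r A 𝒳 Θ) (q : PMF ℕ) {lam : Fin k → ℝ}
  (S : Fin k → ∀ m, Finset (Fin m)) {θ : EuclideanSpace ℝ (Fin r)}

/-- The contribution of one partially labelled data point to the log-likelihood. -/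
noncomputable def logLikTerm (w : SeqData A 𝒳 × Fin k) (θ : EuclideanSpace ℝ (Fin r)) : ℝ :=
  M.logPartial w.1.1 (S w.2 w.1.1) w.1.2 θ

theorem logLik_eq_sum (d : ℕ → SeqData A 𝒳) (c : ℕ → Fin k) (n : ℕ)
    (θ : EuclideanSpace ℝ (Fin r)) :
    M.logLik S d c n θ = ∑ i ∈ Finset.range n, M.logLikTerm S (d i, c i) θ := by
  simp [logLik, logLikTerm]

variable [MeasurableSpace A] [DiscreteMeasurableSpace A]

theorem measurable_logLikTerm (hθ : θ ∈ Θ) : Measurable fun w => M.logLikTerm S w θ :=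
  measurable_of_seqData (f := fun w : SeqData A 𝒳 × Fin k => M.logLikTerm S w θ)
    fun m j => M.measurable_logPartial (S j m) hθ

/-- The Kullback-Leibler criterion has a unique maximizer at the true parameter. -/
theorem eq_of_integral_logLikTerm_le (hlam : ∀ j, 0 < lam j)
    (h_ident : M.Identifiable q) (h_policy : M.PolicyIdentifiable q S)
    (hlaw : IsProbabilityMeasure ((M.law q θ).prod (policyLaw lam)))
    {η : EuclideanSpace ℝ (Fin r)} (hθ : θ ∈ Θ) (hη : η ∈ Θ)
    (hiθ : Integrable (fun w => M.logLikTerm S w θ) ((M.law q θ).prod (policyLaw lam)))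
    (hiη : Integrable (fun w => M.logLikTerm S w η) ((M.law q θ).prod (policyLaw lam)))
    (hle : ∫ w, M.logLikTerm S w θ ∂(M.law q θ).prod (policyLaw lam) ≤
      ∫ w, M.logLikTerm S w η ∂(M.law q θ).prod (policyLaw lam)) : η = θ := by
  set ν := (M.law q θ).prod (policyLaw lam) with hν
  let d : SeqData A 𝒳 × Fin k → ℝ := fun w => M.logLikTerm S w η - M.logLikTerm S w θ
  have hdm : Measurable d := (M.measurable_logLikTerm S hη).sub (M.measurable_logLikTerm S hθ)
  -- Over each (m, j) the likelihood ratio integrates to 1, so its total integral is the total mass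
  -- of ν.
  have hlin : ∫⁻ w, ENNReal.ofReal (Real.exp (d w)) ∂ν = 1 := by
    have h1 : ∫⁻ _, 1 ∂ν = ∑' m, q m * ∑ j, ENNReal.ofReal (lam j) *
        ∫⁻ _, 1 ∂(M.lawOfLength θ m) :=
      M.lintegral_law_prod_policyLaw q hθ lam measurable_const
    have hp := M.isProbabilityMeasure_lawOfLength hθ
    simp only [lintegral_const, measure_univ, mul_one] at h1
    rw [M.lintegral_law_prod_policyLaw q hθ lam hdm.exp.ennreal_ofReal, h1]
    refine tsum_congr fun m => ?_
    congr 1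
    refine Finset.sum_congr rfl fun j _ => ?_
    have h2 := M.integral_exp_logPartial_sub (m := m) hθ hη (S j m)
    have h3 := ofReal_integral_eq_lintegral_ofReal h2.1
      (Eventually.of_forall fun z => (Real.exp_pos _).le)
    rw [h2.2, ENNReal.ofReal_one] at h3
    exact (congrArg _ h3.symm).trans (mul_one _)
  have hei : Integrable (fun w => Real.exp (d w)) ν :=
    (lintegral_ofReal_ne_top_iff_integrable hdm.exp.aestronglyMeasurable
      (Eventually.of_forall fun w => (Real.exp_pos _).le)).1 (by rw [hlin]; exact ENNReal.one_ne_top)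
  have he1 : ∫ w, Real.exp (d w) ∂ν = 1 := by
    rw [integral_eq_lintegral_of_nonneg_ae (Eventually.of_forall fun w => (Real.exp_pos _).le)
      hdm.exp.aestronglyMeasurable, hlin, ENNReal.toReal_one]
  have hdi : Integrable d ν := hiη.sub hiθ
  have he1i : Integrable (fun w => Real.exp (d w) - 1) ν := hei.sub (integrable_const 1)
  have hgap_int : Integrable (fun w => Real.exp (d w) - 1 - d w) ν :=
    he1i.sub hdi
  have hnn : ∀ w, 0 ≤ Real.exp (d w) - 1 - d w := fun w => by
    linarith [Real.add_one_le_exp (d w)]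
  -- The integral equals -∫ d, at most zero by `hle`, while the integrand is nonnegative; strictness
  -- of eˣ > 1 + x off zero then forces d = 0.
  have hgap : ∫ w, (Real.exp (d w) - 1 - d w) ∂ν = 0 := by
    refine le_antisymm ?_ (integral_nonneg hnn)
    rw [integral_sub he1i hdi, integral_sub hei (integrable_const 1),
      he1, integral_sub hiη hiθ]
    simp only [integral_const, probReal_univ, smul_eq_mul, mul_one]
    linarith
  rw [integral_eq_zero_iff_of_nonneg hnn hgap_int] at hgap
  have hd0 : ∀ᵐ w ∂ν, d w = 0 := by
    filter_upwards [hgap] with w hw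
    by_contra hne
    have := Real.add_one_lt_exp hne
    simp only [Pi.zero_apply] at hw
    linarith
  refine h_ident η hη θ hθ (h_policy η hη θ hθ fun m hm j y => ?_)
  have h1 := M.ae_of_ae_lawOfLength hθ (M.ae_lawOfLength_of_ae q hlam hθ hd0 hm j) y
  filter_upwards [h1] with x hx
  exact Real.log_injOn_pos (M.partialDensity_pos (S j m) hη x y)
    (M.partialDensity_pos (S j m) hθ x y) (sub_eq_zero.1 hx)

end SeqModel

/-! ### The main theorem -/

theorem proposition4 {r k : ℕ} {A : Type*} [Fintype A] [DecidableEq A] [MeasurableSpace A]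
    [DiscreteMeasurableSpace A] {𝒳 : ℕ → Type*} [∀ m, MeasurableSpace (𝒳 m)]
    -- the parameter set and the true parameter
    (Θ : Set (EuclideanSpace ℝ (Fin r))) (hΘ_compact : IsCompact Θ) (hΘ_convex : Convex ℝ Θ)
    (θ₀ : EuclideanSpace ℝ (Fin r)) (hθ₀ : θ₀ ∈ interior Θ)
    -- the model, the length distribution and the labelling policy
    (M : SeqModel r A 𝒳 Θ) (q : PMF ℕ) (lam : Fin k → ℝ) (S : Fin k → ∀ m, Finset (Fin m))
    (hlam_pos : ∀ j, 0 < lam j) (hlam_sum : ∑ j, lam j = 1)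
    (h_ident : M.Identifiable q) (h_policy : M.PolicyIdentifiable q S)
    -- smoothness and the classical regularity conditions
    (h_smooth : ∀ m x y, ContDiffOn ℝ 2 (fun θ => M.density m θ x y) Θ)
    (h_envelope : ∃ K : SeqData A 𝒳 → ℝ, Integrable K (M.law q θ₀) ∧
      (∀ m, q m ≠ 0 → ∀ j z, ∀ θ ∈ Θ, |M.logPartial m (S j m) z θ| ≤ K ⟨m, z⟩) ∧
      (∀ᶠ θ in 𝓝 θ₀, ∀ m, q m ≠ 0 → ∀ j z,
        ‖fderiv ℝ (fderiv ℝ (M.logPartial m (S j m) z)) θ‖ ≤ K ⟨m, z⟩))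
    (h_dominated : ∀ m, q m ≠ 0 → ∀ y, ∃ G : 𝒳 m → ℝ, Integrable G (M.base m) ∧
      ∀ᶠ θ in 𝓝 θ₀, ∀ x, ‖fderiv ℝ (fderiv ℝ (fun η => M.density m η x y)) θ‖ ≤ G x)
    (h_nonsing : IsUnit (M.infoMatrix q lam S θ₀).det)
    -- the i.i.d. data `D i` and the i.i.d. labelling draws `C i`, independent of the data
    {Ω : Type*} [MeasurableSpace Ω] (P : Measure Ω) [IsProbabilityMeasure P]
    (D : ℕ → Ω → SeqData A 𝒳) (C : ℕ → Ω → Fin k)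
    (h_law : ∀ i, HasLaw (fun ω => (D i ω, C i ω)) ((M.law q θ₀).prod (policyLaw lam)) P)
    (h_indep : iIndepFun (fun i ω => (D i ω, C i ω)) P)
    -- the estimator: a maximizer over `Θ` of the log-likelihood
    (θhat : ℕ → Ω → EuclideanSpace ℝ (Fin r)) (h_meas : ∀ n, AEMeasurable (θhat n) P)
    (h_max : ∀ᵐ ω ∂P, ∀ n, θhat n ω ∈ Θ ∧
      IsMaxOn (M.logLik S (fun i => D i ω) (fun i => C i ω) n) Θ (θhat n ω)) :
    -- the score covariances exist, and so does their `q`-average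
    (∀ m, q m ≠ 0 → ∀ j, MemLp (M.score m (S j m) θ₀) 2 (M.lawOfLength θ₀ m)) ∧
    (∀ a b, Summable fun m => (q m).toReal * ∑ j, lam j * M.scoreCov m (S j m) θ₀ a b) ∧
    -- asymptotic normality
    TendstoInDistribution (fun (n : ℕ) ω => √(n : ℝ) • (θhat n ω - θ₀)) atTop id (fun _ => P)
      (multivariateGaussian 0 (M.infoMatrix q lam S θ₀)⁻¹) := by
  obtain ⟨K, hK, hKV, hKH⟩ := h_envelope
  have hθΘ : θ₀ ∈ Θ := interior_subset hθ₀
  set ν := (M.law q θ₀).prod (policyLaw lam) with hν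
  have hνp : IsProbabilityMeasure ν := by
    rw [← (h_law 0).map_eq]
    exact Measure.isProbabilityMeasure_map (h_law 0).aemeasurable
  have hKν : Integrable (fun w : SeqData A 𝒳 × Fin k => K w.1) ν := hK.comp_fst _
  have hlen := M.ae_length_ne_zero q hθΘ lam
  have hsmi : ∀ m x y, ContDiffOn ℝ 2 (fun θ => M.density m θ x y) (interior Θ) := fun m x y =>
    (h_smooth m x y).mono interior_subset
  have hKH₀ := hKH.self_of_nhds
  -- Hessians at the true parameter
  have hHm : ∀ m j u v, Measurable fun z =>
      fderiv ℝ (fderiv ℝ (M.logPartial m (S j m) z)) θ₀ u v := fun m j u v =>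
    measurable_fderiv_fderiv_apply isOpen_interior
      (fun θ h => M.measurable_logPartial (S j m) (interior_subset h))
      (fun z => M.contDiffOn_logPartial interior_subset (hsmi m) (S j m) z) hθ₀ u v
  have hHν : ∀ u v, Integrable (fun w => fderiv ℝ (fderiv ℝ (M.logLikTerm S w)) θ₀ u v) ν := by
    intro u v
    refine ((hKν.mul_const ‖u‖).mul_const ‖v‖).mono'
      (SeqModel.measurable_of_seqData fun m j => hHm m j u v).aestronglyMeasurable ?_
    filter_upwards [hlen] with w hw
    refine (ContinuousLinearMap.le_opNorm₂ _ u v).trans ?_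
    gcongr
    exact hKH₀ w.1.1 hw w.2 w.1.2
  have hHP : ∀ m, q m ≠ 0 → ∀ j u v, Integrable (fun z =>
      fderiv ℝ (fderiv ℝ (M.logPartial m (S j m) z)) θ₀ u v) (M.lawOfLength θ₀ m) :=
    fun m hm j u v => (M.integrable_lawOfLength_of_integrable q hlam_pos hθΘ (hHν u v) hm
      j).comp_measurable (SeqModel.measurable_mk_mk m j)
  -- the score at each length
  have hfix : ∀ m, q m ≠ 0 → ∀ j,
      (∀ v, MemLp (fun z => fderiv ℝ (M.logPartial m (S j m) z) θ₀ v) 2 (M.lawOfLength θ₀ m)) ∧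
      (∀ v, ∫ z, fderiv ℝ (M.logPartial m (S j m) z) θ₀ v ∂(M.lawOfLength θ₀ m) = 0) ∧
      (∀ u v, ∫ z, fderiv ℝ (M.logPartial m (S j m) z) θ₀ u *
        fderiv ℝ (M.logPartial m (S j m) z) θ₀ v ∂(M.lawOfLength θ₀ m) =
        - ∫ z, fderiv ℝ (fderiv ℝ (M.logPartial m (S j m) z)) θ₀ u v ∂(M.lawOfLength θ₀ m)) := by
    intro m hm j
    choose G hG hbd using h_dominated m hm
    -- The domination neighbourhoods depend on y; there are finitely many label sequences, so they
    -- have a common one.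
    have hev : ∀ᶠ θ in 𝓝 θ₀, θ ∈ interior Θ ∧
        ∀ y x, ‖fderiv ℝ (fderiv ℝ (fun η => M.density m η x y)) θ‖ ≤ G y x :=
      (isOpen_interior.eventually_mem hθ₀).and (eventually_all.2 hbd)
    obtain ⟨U, hU, hUo, hU₀⟩ := eventually_nhds_iff.1 hev
    exact M.integral_fderiv_logPartial_mul hUo (fun θ h => interior_subset (hU θ h).1)
      (fun x y => (hsmi m x y).mono fun θ h => (hU θ h).1)
      (fun y => ⟨G y, hG y, fun θ h x => (hU θ h).2 y x⟩) hU₀ (S j m) (hHP m hm j)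
  have hsm : ∀ m j v, Measurable fun z => fderiv ℝ (M.logPartial m (S j m) z) θ₀ v :=
    fun m j v => M.measurable_fderiv_logPartial_apply isOpen_interior interior_subset (hsmi m)
      hθ₀ (S j m) v
  have hsmν : ∀ v, Measurable fun w => fderiv ℝ (M.logLikTerm S w) θ₀ v := fun v =>
    SeqModel.measurable_of_seqData fun m j => hsm m j v
  have hsL2 : ∀ v, MemLp (fun w => fderiv ℝ (M.logLikTerm S w) θ₀ v) 2 ν := by
    intro v
    rw [memLp_two_iff_integrable_sq (hsmν v).aestronglyMeasurable]
    refine (lintegral_ofReal_ne_top_iff_integrable ((hsmν v).pow_const 2).aestronglyMeasurable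
      (Eventually.of_forall fun w => sq_nonneg _)).1 ?_
    -- Component by component, the information equality bounds the squared score's integral by that
    -- of the Hessian's absolute value, whose mixture total is finite.
    refine ne_top_of_le_ne_top (hHν v v).2.ne ?_
    rw [M.lintegral_law_prod_policyLaw q hθΘ lam ((hsmν v).pow_const 2).ennreal_ofReal,
      M.lintegral_law_prod_policyLaw q hθΘ lam
        (SeqModel.measurable_of_seqData fun m j => hHm m j v v).enorm]
    refine ENNReal.tsum_le_tsum fun m => ?_
    by_cases hm : q m = 0
    · simp [hm]
    refine mul_le_mul' le_rfl (Finset.sum_le_sum fun j _ => mul_le_mul' le_rfl ?_)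
    obtain ⟨h1, -, h3⟩ := hfix m hm j
    refine (ofReal_integral_eq_lintegral_ofReal (h1 v).integrable_sq
      (Eventually.of_forall fun z => sq_nonneg _)).symm.le.trans ?_
    simp_rw [sq]
    rw [h3 v v]
    refine (Real.ofReal_le_enorm _).trans ?_
    rw [enorm_neg]
    exact enorm_integral_le_lintegral_enorm _
  have hs0 : ∀ v, ∫ w, fderiv ℝ (M.logLikTerm S w) θ₀ v ∂ν = 0 := by
    intro v
    refine (M.hasSum_integral_lawOfLength q hlam_pos hθΘ
      ((hsL2 v).integrable (by norm_num))).unique ?_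
    convert hasSum_zero using 1
    ext m
    by_cases hm : q m = 0
    · simp [hm]
    · refine mul_eq_zero_of_right _ (Finset.sum_eq_zero fun j _ => mul_eq_zero_of_right _ ?_)
      exact (hfix m hm j).2.1 v
  have hcov : ∀ m, q m ≠ 0 → ∀ j a b, M.scoreCov m (S j m) θ₀ a b =
      ∫ z, fderiv ℝ (M.logPartial m (S j m) z) θ₀ (EuclideanSpace.single a 1) *
        fderiv ℝ (M.logPartial m (S j m) z) θ₀ (EuclideanSpace.single b 1)
        ∂(M.lawOfLength θ₀ m) := by
    intro m hm j a b
    have hp := M.isProbabilityMeasure_lawOfLength hθΘ m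
    obtain ⟨h1, h2, -⟩ := hfix m hm j
    simp only [SeqModel.scoreCov, SeqModel.score, Matrix.of_apply, gradient_ofLp]
    rw [covariance_eq_sub (h1 _) (h1 _), h2]
    simp
  have hsum : ∀ a b, HasSum
      (fun m => (q m).toReal * ∑ j, lam j * M.scoreCov m (S j m) θ₀ a b)
      (∫ w, fderiv ℝ (M.logLikTerm S w) θ₀ (EuclideanSpace.single a 1) *
        fderiv ℝ (M.logLikTerm S w) θ₀ (EuclideanSpace.single b 1) ∂ν) := by
    intro a b
    convert M.hasSum_integral_lawOfLength q hlam_pos hθΘ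
      (f := fun w => fderiv ℝ (M.logLikTerm S w) θ₀ (EuclideanSpace.single a 1) *
        fderiv ℝ (M.logLikTerm S w) θ₀ (EuclideanSpace.single b 1))
      ((hsL2 _).integrable_mul (hsL2 _)) using 1
    ext m
    by_cases hm : q m = 0
    · simp [hm]
    · simp_rw [hcov m hm]
      rfl
  have hinfo : ∀ a b, ∫ w, fderiv ℝ (M.logLikTerm S w) θ₀ (EuclideanSpace.single a 1) *
      fderiv ℝ (M.logLikTerm S w) θ₀ (EuclideanSpace.single b 1) ∂ν =
      M.infoMatrix q lam S θ₀ a b := fun a b => (hsum a b).tsum_eq.symm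
  have hhess : ∀ a b, ∫ w, fderiv ℝ (fderiv ℝ (M.logLikTerm S w)) θ₀ (EuclideanSpace.single a 1)
      (EuclideanSpace.single b 1) ∂ν = - M.infoMatrix q lam S θ₀ a b := by
    intro a b
    rw [← hinfo a b]
    -- The global information equality: both sides are sums over lengths of the same fixed-length
    -- terms.
    refine (M.hasSum_integral_lawOfLength q hlam_pos hθΘ (hHν _ _)).unique ?_
    convert (hsum a b).neg using 1
    · rfl
    ext m
    by_cases hm : q m = 0
    · simp [hm]
    · rw [← mul_neg, ← Finset.sum_neg_distrib]
      congr 1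
      refine Finset.sum_congr rfl fun j _ => ?_
      rw [hcov m hm, (hfix m hm j).2.2, mul_neg, neg_neg]
      rfl
  have hbd : ∀ᵐ w ∂ν, ∀ θ ∈ Θ, |M.logLikTerm S w θ| ≤ K w.1 := by
    filter_upwards [hlen] with w hw θ hθ using hKV w.1.1 hw w.2 w.1.2 θ hθ
  have hVi : ∀ θ ∈ Θ, Integrable (fun w => M.logLikTerm S w θ) ν := fun θ hθ =>
    hKν.mono' (M.measurable_logLikTerm S hθ).aestronglyMeasurable (hbd.mono fun w hw => hw θ hθ)
  refine ⟨fun m hm j => memLp_piLp_iff.2 fun a => ?_, fun a b => (hsum a b).summable, ?_⟩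
  · simp only [SeqModel.score, gradient_ofLp]
    exact (hfix m hm j).1 _
  -- The neighbourhood `U` is the set where the Hessian bound holds, so `hKH` itself is its
  -- neighbourhood proof.
  · refine tendstoInDistribution_of_isMaxOn_sum (V := M.logLikTerm S) hΘ_compact hθ₀
      (fun θ hθ => M.measurable_logLikTerm S hθ)
      (fun w => M.contDiffOn_logPartial subset_rfl (h_smooth w.1.1) _ _) hKν hbd hKH ?_
      (fun θ hθ hle => M.eq_of_integral_logLikTerm_le q S hlam_pos h_ident h_policy hνp hθΘ hθ
        (hVi θ₀ hθΘ) (hVi θ hθ) hle) hsL2 hs0 h_nonsing hinfo hhess h_law h_indep h_meas ?_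
    · filter_upwards [hlen] with w hw θ hθ using hθ w.1.1 hw w.2 w.1.2
    · filter_upwards [h_max] with ω hω n
      refine ⟨(hω n).1, ?_⟩
      have := (hω n).2
      rwa [funext fun θ => M.logLik_eq_sum S (fun i => D i ω) (fun i => C i ω) n θ] at this
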